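/- Let $k\ge 3$, and let $\widehat{X_n^k}$ be the rooted tree of depth $n$ in which the root has $k$ children, every other non-leaf has $k-1$ children, and all leaves are at distance $n$ from the root. Let $\mathcal{U}_n$ be the uniform distribution, counted with multiplicity, on the normalized eigenvalues $\frac{\lambda+k}{2k}$, where $\lambda$ runs over the eigenvalues of the adjacency matrix of $\widehat{X_n^k}$, and for a probability distribution $\nu$ on $\mathbb{R}$ let $q_\nu(t)=\inf\{x: t\le \nu((-\infty,x])\}$, $0<t<1$, be its quantile function (so $q_{\mathcal{U}_n}$ is the plot of the normalized eigenvalues in increasing order, with the horizontal axis rescaled to $(0,1)$). Then: 1. $\mathcal{U}_n$ converges weakly, as $n\to\infty$, to a probability distribution $\mu$ which is singular with respect to Lebesgue measure, and $q_{\mathcal{U}_n}(t)\to q_\mu(t)$ for all $0<t<1$. 2. $q_\mu$ extends to a continuous nondecreasing function $F$ on $\mathbb{R}$ that is constant on $(-\infty,0]$ and on $[1,\infty)$. The measure $dF$ is singular with respect to Lebesgue measure, and its support $S$ is a Lebesgue null set with $\min S=0$ and $\max S=1$. 3. The endpoints of $S$, that is, the endpoints of the bounded connected components of $\mathbb{R}\setminus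 S$ (the maximal open intervals in $(0,1)$ on which $F$ is constant), are exactly the numbers $$\varepsilon\,\frac{(k-2)^2}{(k-1)^m-1}+\sum_{n=1}^\infty \frac{(k-2)^2}{(k-1)^n-1}\,\#\Big\{\ell\in\mathbb{N}:\ \ell\ge 1,\ \gcd(\ell,n)=1,\ \ell<\frac{an}{m}\Big\},$$ where $\varepsilon\in\{0,1\}$ and $a,m$ are integers with $0<a<m$ and $\gcd(a,m)=1$ (the series converges). -/

import Mathlib

open MeasureTheory Set Filter Topology

/-! ### The finite subtrees of the infinite regular tree

A vertex is the list of choices made on the way down from the root, the most recent choice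
first, so that the root is `[]` and the children of `v` are the lists `i :: v`. -/

/-- The vertices at distance `d` from the root: the root has `k` children,
every other vertex has `k - 1` children. -/
def treeSphere (k : ℕ) : ℕ → Finset (List ℕ)
  | 0 => {[]}
  | d + 1 => (treeSphere k d ×ˢ Finset.range (if d = 0 then k else k - 1)).image
      (fun p => p.2 :: p.1)

/-- The vertices of the rooted tree of depth `n`. -/
def treeBall (k n : ℕ) : Finset (List ℕ) :=
  (Finset.range (n + 1)).biUnion (treeSphere k)

theorem nil_mem_treeBall (k n : ℕ) : ([] : List ℕ) ∈ treeBall k n :=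
  Finset.mem_biUnion.2 ⟨0, Finset.mem_range.2 n.succ_pos, by simp [treeSphere]⟩

instance (k n : ℕ) : Nonempty (treeBall k n) := ⟨⟨[], nil_mem_treeBall k n⟩⟩

/-- The finite rooted tree of depth `n` in which the root has `k` children, every other
non-leaf has `k - 1` children (hence every non-leaf has degree `k`), and all leaves are at
distance `n` from the root. Two vertices are adjacent when one is a child of the other. -/
def regularSubtree (k n : ℕ) : SimpleGraph (treeBall k n) where
  Adj u v := (∃ i, u.1 = i :: v.1) ∨ (∃ i, v.1 = i :: u.1)
  symm := ⟨fun _ _ h => h.symm⟩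
  loopless := ⟨by
    rintro u (⟨i, h⟩ | ⟨i, h⟩) <;> simpa using congrArg List.length h⟩

noncomputable instance (k n : ℕ) : DecidableRel (regularSubtree k n).Adj :=
  fun _ _ => Classical.propDecidable _

/-! ### Normalized spectra and their distributions -/

/-- The normalized adjacency eigenvalues `(λ + k) / (2 k)`, listed with multiplicity
(the family is indexed by the vertices, as many eigenvalues as vertices). -/
noncomputable def nSpec (k n : ℕ) (i : treeBall k n) : ℝ :=
  (((regularSubtree k n).isHermitian_adjMatrix ℝ).eigenvalues i + k) / (2 * k)

/-- The uniform distribution on the normalized adjacency eigenvalues, with multiplicity. -/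
noncomputable def uniformNSpec (k n : ℕ) : ProbabilityMeasure ℝ :=
  ⟨((PMF.uniformOfFintype (treeBall k n)).map (nSpec k n)).toMeasure, inferInstance⟩

/-- The quantile function of a probability distribution on the line (to be used for
`0 < t < 1`). For the uniform distribution on `N` listed values it is the plot of the values in
increasing order, the `j`-th smallest value being taken on `((j - 1) / N, j / N]`. -/
noncomputable def quantile (μ : ProbabilityMeasure ℝ) (t : ℝ) : ℝ :=
  sInf {x : ℝ | t ≤ (μ : Measure ℝ).real (Iic x)}

/-! ### Endpoints -/

/-- The endpoints of the gaps of a closed set `S` of reals, i.e. of the bounded connected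
components `(u, v)` of the complement of `S`. -/
def gapEndpoints (S : Set ℝ) : Set ℝ :=
  {x | ∃ u v : ℝ, u < v ∧ u ∈ S ∧ v ∈ S ∧ Disjoint (Ioo u v) S ∧ (x = u ∨ x = v)}

/-- The weight `(k - 2)² / ((k - 1)ᵐ - 1)`. -/
noncomputable def stairWidth (k m : ℕ) : ℝ :=
  ((k : ℝ) - 2) ^ 2 / (((k : ℝ) - 1) ^ m - 1)

/-- The number of `ℓ ≥ 1` coprime to `n` with `ℓ < a n / m`; for `0 < a < m` such `ℓ`
lie in `[1, n]`. -/
def coprimeCount (a m n : ℕ) : ℕ :=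
  ((Finset.Icc 1 n).filter (fun l => Nat.Coprime l n ∧ (l : ℚ) < (a : ℚ) * n / m)).card

/-- The numbers `ε w(m) + ∑_{n ≥ 1} w(n) #{ℓ : (ℓ, n) = 1, ℓ < a n / m}`, where `w` is
`stairWidth k`, `ε ∈ {0, 1}`, and `a / m` is a fraction in lowest terms in `(0, 1)`. -/
def stairEndpoints (k : ℕ) : Set ℝ :=
  {x | ∃ m a : ℕ, ∃ ε s : ℝ, 0 < a ∧ a < m ∧ Nat.Coprime a m ∧ (ε = 0 ∨ ε = 1) ∧
    HasSum (fun n : ℕ => stairWidth k (n + 1) * (coprimeCount a m (n + 1) : ℝ)) s ∧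
    x = ε * stairWidth k m + s}

open scoped ENNReal

/-! Put `q = k - 1`. Eliminating the tree from the leaves to the root gives pivots that depend only
on the depth and are quotients of consecutive polynomials `P_j` with `P_{j+2} = x P_{j+1} - q P_j`;
only the root pivot differs. These are rescaled Chebyshev polynomials of the second kind, and the
roots of `P_{n-1}` correspond to the fractions `l / n`, `0 < l < n`. The characteristic polynomial
is therefore, up to a factor of degree linear in the depth, a product of powers of `P_{j+1} / P_j`
(`charpoly_regularSubtree_mul`).

Let `N(n)` be the number of nodes `l / n` whose value lies in a set `E`. Counting roots in `E` and
dividing by the number of vertices, which grows like `q ^ n`, gives in the limit the sum of `(q - 1)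
/ q ^ (h + 1) * (N(h + 2) - N(h + 1))`. Summation by parts turns it into the sum of `(q - 1)² / q ^
n * N(n)` (`tendsto_rootCount_div_card`). So the spectral distributions converge on every measurable
set to a purely atomic measure. Collecting the multiples `n` of `m` in a geometric series, the atom
at a reduced fraction `a / m` has mass `stairWidth k m`.

The rest concerns any probability measure concentrated on countably many atoms dense in an interval
(`DenselyAtomic`). Density of the atoms makes the distribution function strictly increasing there,
hence the quantile function continuous. Each atom `d` produces a flat piece from `μ (Iio d)` to `μ
(Iic d)`, of length `μ {d}`. These lengths add up to 1, so what remains of `[0, 1]` is a null set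
carrying `dF`, and its gaps are exactly the flat pieces. -/

/-! ### Vertices of the tree and their number -/

theorem mem_treeSphere_succ {k d : ℕ} {v : List ℕ} : v ∈ treeSphere k (d + 1) ↔
    ∃ i u, u ∈ treeSphere k d ∧ i < (if d = 0 then k else k - 1) ∧ v = i :: u := by
  simp only [treeSphere, Finset.mem_image, Finset.mem_product, Finset.mem_range, Prod.exists]
  constructor
  · rintro ⟨u, i, ⟨hu, hi⟩, rfl⟩
    exact ⟨i, u, hu, hi, rfl⟩
  · rintro ⟨i, u, hu, hi, rfl⟩
    exact ⟨u, i, ⟨hu, hi⟩, rfl⟩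

theorem cons_mem_treeSphere_succ {k d i : ℕ} {u : List ℕ} : i :: u ∈ treeSphere k (d + 1) ↔
    u ∈ treeSphere k d ∧ i < (if d = 0 then k else k - 1) := by
  rw [mem_treeSphere_succ]
  constructor
  · rintro ⟨j, v, hv, hj, h⟩
    obtain ⟨rfl, rfl⟩ := List.cons.inj h
    exact ⟨hv, hj⟩
  · rintro ⟨hu, hi⟩
    exact ⟨i, u, hu, hi, rfl⟩

theorem length_of_mem_treeSphere {k : ℕ} : ∀ {d : ℕ} {v : List ℕ},
    v ∈ treeSphere k d → v.length = d
  | 0, v, h => by simpa [treeSphere] using h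
  | d + 1, v, h => by
    obtain ⟨i, u, hu, -, rfl⟩ := mem_treeSphere_succ.1 h
    simp [length_of_mem_treeSphere hu]

theorem mem_treeBall {k n : ℕ} {v : List ℕ} :
    v ∈ treeBall k n ↔ v.length ≤ n ∧ v ∈ treeSphere k v.length := by
  simp only [treeBall, Finset.mem_biUnion, Finset.mem_range, Nat.lt_succ_iff]
  constructor
  · rintro ⟨d, hd, hv⟩
    obtain rfl := length_of_mem_treeSphere hv
    exact ⟨hd, hv⟩
  · rintro ⟨hd, hv⟩
    exact ⟨_, hd, hv⟩

theorem card_treeSphere_succ (k d : ℕ) : (treeSphere k (d + 1)).card = k * (k - 1) ^ d := by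
  have step : ∀ d, (treeSphere k (d + 1)).card =
      (treeSphere k d).card * (if d = 0 then k else k - 1) := by
    intro d
    rw [treeSphere, Finset.card_image_of_injective, Finset.card_product, Finset.card_range]
    rintro ⟨u, i⟩ ⟨v, j⟩ h
    obtain ⟨rfl, rfl⟩ := List.cons.inj h
    rfl
  induction d with
  | zero => rw [step]; simp [treeSphere]
  | succ d ih => rw [step, ih, if_neg d.succ_ne_zero, pow_succ, mul_assoc]

theorem pairwiseDisjoint_treeSphere (k : ℕ) (s : Set ℕ) : s.PairwiseDisjoint (treeSphere k) := by
  intro a _ b _ hab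
  refine Finset.disjoint_left.2 fun v ha hb => hab ?_
  rw [← length_of_mem_treeSphere ha, ← length_of_mem_treeSphere hb]

theorem prod_treeBall_length {M : Type*} [CommMonoid M] (k n : ℕ) (f : ℕ → M) :
    ∏ v : treeBall k n, f v.1.length =
      ∏ d ∈ Finset.range (n + 1), f d ^ (treeSphere k d).card := by
  rw [Finset.prod_coe_sort (treeBall k n) (fun v => f v.length), treeBall,
    Finset.prod_biUnion (pairwiseDisjoint_treeSphere k _)]
  refine Finset.prod_congr rfl fun d _ => ?_
  rw [Finset.prod_congr rfl fun v hv => by rw [length_of_mem_treeSphere hv], Finset.prod_const]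

theorem card_treeBall (k n : ℕ) :
    (treeBall k n).card = 1 + ∑ d ∈ Finset.range n, k * (k - 1) ^ d := by
  rw [treeBall, Finset.card_biUnion (pairwiseDisjoint_treeSphere k _), Finset.sum_range_succ',
    add_comm, Finset.sum_congr rfl fun d _ => card_treeSphere_succ k d]
  simp [treeSphere]

/-! ### The adjacency matrix and its elimination -/

open Classical in
/-- The incidence of parents (rows) with their children (columns). -/
noncomputable def childMatrix (k n : ℕ) : Matrix (treeBall k n) (treeBall k n) ℝ :=
  Matrix.of fun u w => if ∃ i, w.1 = i :: u.1 then 1 else 0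

open Classical in
theorem childMatrix_apply (k n : ℕ) (u w : treeBall k n) :
    childMatrix k n u w = if ∃ i, w.1 = i :: u.1 then 1 else 0 := rfl

theorem regularSubtree_adj {k n : ℕ} {u v : treeBall k n} : (regularSubtree k n).Adj u v ↔
    (∃ i, u.1 = i :: v.1) ∨ ∃ i, v.1 = i :: u.1 := Iff.rfl

theorem adjMatrix_regularSubtree (k n : ℕ) :
    (regularSubtree k n).adjMatrix ℝ = childMatrix k n + (childMatrix k n).transpose := by
  ext u v
  simp only [SimpleGraph.adjMatrix_apply, Matrix.add_apply, Matrix.transpose_apply,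
    childMatrix_apply, regularSubtree_adj]
  by_cases h1 : ∃ i, u.1 = i :: v.1 <;> by_cases h2 : ∃ i, v.1 = i :: u.1
  · obtain ⟨i, h1⟩ := h1
    obtain ⟨j, h2⟩ := h2
    have := congrArg List.length h1
    have := congrArg List.length h2
    simp at *
    omega
  all_goals simp [h1, h2, regularSubtree_adj]

open Classical in
theorem card_children (k n : ℕ) (u : treeBall k n) :
    (Finset.univ.filter fun w : treeBall k n => ∃ i, w.1 = i :: u.1).card =
      if u.1.length < n then (if u.1.length = 0 then k else k - 1) else 0 := by
  obtain ⟨hl, hu⟩ := mem_treeBall.1 u.2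
  split_ifs with h
  on_goal 3 =>
    rw [Finset.card_eq_zero, Finset.filter_eq_empty_iff]
    rintro w - ⟨i, hw⟩
    have h1 := (mem_treeBall.1 w.2).1
    rw [hw, List.length_cons] at h1
    omega
  all_goals
    rename_i h0
    refine (Finset.card_bij (s := Finset.range (if u.1.length = 0 then k else k - 1))
      (fun i hi => (⟨i :: u.1, mem_treeBall.2 ⟨by simpa using h,
        cons_mem_treeSphere_succ.2 ⟨hu, Finset.mem_range.1 hi⟩⟩⟩ : treeBall k n))
      (fun i hi => by simp) (fun i _ j _ hij => by simpa using hij) ?_).symm.trans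
      (by simp [h0])
    intro w hw
    obtain ⟨i, hi⟩ := (Finset.mem_filter.1 hw).2
    have hw' := (mem_treeBall.1 w.2).2
    rw [hi, List.length_cons, cons_mem_treeSphere_succ] at hw'
    exact ⟨i, Finset.mem_range.2 hw'.2, Subtype.ext hi.symm⟩

-- A vertex has only one parent, so distinct rows of the incidence matrix have disjoint supports and
-- the product is diagonal; a diagonal entry sums `f` over the children.
open Classical in
theorem childMatrix_mul_diagonal_mul_transpose (k n : ℕ) (f : ℕ → ℝ) :
    childMatrix k n * Matrix.diagonal (fun w => f w.1.length) * (childMatrix k n).transpose =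
      Matrix.diagonal fun u => if u.1.length < n then
        ((if u.1.length = 0 then k else k - 1 : ℕ) : ℝ) * f (u.1.length + 1) else 0 := by
  ext u v
  rw [Matrix.mul_apply]
  simp only [Matrix.mul_diagonal, Matrix.transpose_apply, childMatrix_apply]
  by_cases huv : u = v
  · subst huv
    rw [Matrix.diagonal_apply_eq]
    have : ∀ w : treeBall k n, (((if ∃ i, w.1 = i :: u.1 then 1 else 0) * f w.1.length) *
        (if ∃ i, w.1 = i :: u.1 then 1 else 0) : ℝ) =
        if ∃ i, w.1 = i :: u.1 then f (u.1.length + 1) else 0 := by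
      intro w
      split_ifs with h
      · obtain ⟨i, hi⟩ := h
        simp [hi]
      · simp
    rw [Finset.sum_congr rfl fun w _ => this w, ← Finset.sum_filter, Finset.sum_const,
      card_children]
    split_ifs <;> simp
  · rw [Matrix.diagonal_apply_ne _ huv]
    refine Finset.sum_eq_zero fun w _ => ?_
    by_cases h1 : ∃ i, w.1 = i :: u.1
    · rw [if_neg (c := ∃ i, w.1 = i :: v.1), mul_zero]
      rintro ⟨j, hj⟩
      obtain ⟨i, hi⟩ := h1
      exact huv (Subtype.ext (List.cons.inj (hi.symm.trans hj)).2)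
    · rw [if_neg h1, zero_mul, zero_mul]

/-- Edges go from depth `d` to depth `d + 1`, so grading by depth makes the matrix block triangular
with identity blocks. -/
theorem det_one_sub_childMatrix_mul_diagonal (k n : ℕ) (f : treeBall k n → ℝ) :
    (1 - childMatrix k n * Matrix.diagonal f).det = 1 := by
  have hb : Matrix.BlockTriangular (1 - childMatrix k n * Matrix.diagonal f)
      (fun v : treeBall k n => v.1.length) := by
    intro u v huv
    have huv : v.1.length < u.1.length := huv
    have h1 : u ≠ v := by rintro rfl; exact lt_irrefl _ huv
    rw [Matrix.sub_apply, Matrix.one_apply_ne h1, Matrix.mul_diagonal, childMatrix_apply,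
      if_neg, zero_mul, sub_zero]
    rintro ⟨i, hi⟩
    have := congrArg List.length hi
    simp at this
    omega
  rw [hb.det]
  refine Finset.prod_eq_one fun d _ => ?_
  refine (congrArg Matrix.det ?_).trans Matrix.det_one
  ext ⟨u, hu⟩ ⟨v, hv⟩
  rw [Matrix.toSquareBlock_def, Matrix.of_apply, Matrix.sub_apply, Matrix.mul_diagonal,
    childMatrix_apply, if_neg, zero_mul, sub_zero]
  · simp [Matrix.one_apply]
  · rintro ⟨i, hi⟩
    have := congrArg List.length hi
    simp only [List.length_cons] at this
    omega

/-- Gaussian elimination on the tree, from the leaves to the root. -/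
theorem eval_charpoly_regularSubtree (k n : ℕ) (x : ℝ) (δ : ℕ → ℝ) (h0 : ∀ d, δ d ≠ 0)
    (hn : δ n = x)
    (hd : ∀ d < n, δ d + ((if d = 0 then k else k - 1 : ℕ) : ℝ) / δ (d + 1) = x) :
    ((regularSubtree k n).adjMatrix ℝ).charpoly.eval x =
      ∏ d ∈ Finset.range (n + 1), δ d ^ (treeSphere k d).card := by
  set C := childMatrix k n with hC
  set Δ : Matrix (treeBall k n) (treeBall k n) ℝ := Matrix.diagonal fun w => δ w.1.length with hΔ
  set Δ' : Matrix (treeBall k n) (treeBall k n) ℝ :=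
    Matrix.diagonal fun w => (δ w.1.length)⁻¹ with hΔ'
  have hinv : Δ' * Δ = 1 := by
    rw [hΔ, hΔ', Matrix.diagonal_mul_diagonal, ← Matrix.diagonal_one]
    congr 1
    ext w
    exact inv_mul_cancel₀ (h0 _)
  have hinv' : Δ * Δ' = 1 := by
    rw [hΔ, hΔ', Matrix.diagonal_mul_diagonal, ← Matrix.diagonal_one]
    congr 1
    ext w
    exact mul_inv_cancel₀ (h0 _)
  have hdiag : Matrix.scalar _ x = Δ + C * Δ' * C.transpose := by
    rw [hC, hΔ', childMatrix_mul_diagonal_mul_transpose k n fun d => (δ d)⁻¹, hΔ,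
      Matrix.diagonal_add, Matrix.scalar_apply]
    congr 1
    ext u
    have hu := (mem_treeBall.1 u.2).1
    split_ifs with h h'
    · rw [← hd _ h, if_pos h', div_eq_mul_inv]
    · rw [← hd _ h, if_neg h', div_eq_mul_inv]
    · rw [add_zero, show u.1.length = n by omega, hn]
  -- The recursion for `δ` says precisely that the diagonal part of the symmetric factorization is
  -- `x`; the cross terms give the adjacency matrix.
  have key : Matrix.scalar _ x - (regularSubtree k n).adjMatrix ℝ =
      (1 - C * Δ') * Δ * (1 - C * Δ').transpose := by
    have hT : Δ'.transpose = Δ' := Matrix.diagonal_transpose _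
    rw [hdiag, adjMatrix_regularSubtree, ← hC, Matrix.transpose_sub, Matrix.transpose_one,
      Matrix.transpose_mul, hT, sub_mul, one_mul, mul_assoc C Δ' Δ, hinv, mul_one, mul_sub, mul_one,
      sub_mul, ← mul_assoc Δ, hinv', one_mul, mul_assoc C]
    abel
  rw [Matrix.eval_charpoly, key, Matrix.det_mul, Matrix.det_mul, Matrix.det_transpose,
    det_one_sub_childMatrix_mul_diagonal, one_mul, mul_one, Matrix.det_diagonal,
    prod_treeBall_length]

/-! ### Path polynomials and their roots -/

open Polynomial in
/-- The characteristic polynomial of the path with `n` vertices and edges of weight `√c`. -/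
noncomputable def pathPoly (c : ℝ) : ℕ → ℝ[X]
  | 0 => 1
  | 1 => X
  | n + 2 => X * pathPoly c (n + 1) - C c * pathPoly c n

theorem pathPoly_add_two (c : ℝ) (n : ℕ) : pathPoly c (n + 2) =
    Polynomial.X * pathPoly c (n + 1) - Polynomial.C c * pathPoly c n := rfl

theorem pathPoly_monic_and_natDegree (c : ℝ) : ∀ n : ℕ,
    (pathPoly c n).Monic ∧ (pathPoly c n).natDegree = n
  | 0 => by simp [pathPoly]
  | 1 => by simp [pathPoly, Polynomial.monic_X]
  | n + 2 => by
    obtain ⟨h1, h2⟩ := pathPoly_monic_and_natDegree c (n + 1)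
    obtain ⟨h3, h4⟩ := pathPoly_monic_and_natDegree c n
    have hm : (Polynomial.X * pathPoly c (n + 1)).Monic := Polynomial.monic_X.mul h1
    have hd : (Polynomial.X * pathPoly c (n + 1)).natDegree = n + 2 := by
      rw [Polynomial.monic_X.natDegree_mul h1, h2, Polynomial.natDegree_X]; ring
    have hlt : (Polynomial.C c * pathPoly c n).degree <
        (Polynomial.X * pathPoly c (n + 1)).degree := by
      rw [Polynomial.degree_eq_natDegree hm.ne_zero, hd]
      refine lt_of_le_of_lt Polynomial.degree_le_natDegree ?_
      have := (Polynomial.natDegree_C_mul_le c (pathPoly c n)).trans h4.le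
      exact_mod_cast (by omega : (Polynomial.C c * pathPoly c n).natDegree < n + 2)
    rw [pathPoly_add_two]
    refine ⟨hm.sub_of_left hlt, ?_⟩
    rw [Polynomial.natDegree_eq_of_degree_eq (Polynomial.degree_sub_eq_left_of_degree_lt hlt), hd]

theorem pathPoly_ne_zero (c : ℝ) (n : ℕ) : pathPoly c n ≠ 0 :=
  (pathPoly_monic_and_natDegree c n).1.ne_zero

theorem eval_pathPoly_add_two (c x : ℝ) (n : ℕ) : (pathPoly c (n + 2)).eval x =
    x * (pathPoly c (n + 1)).eval x - c * (pathPoly c n).eval x := by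
  simp [pathPoly_add_two]

/-- These are Chebyshev polynomials of the second kind, rescaled; the recursion becomes the addition
formula for the sine. -/
theorem eval_pathPoly_mul_sin {c : ℝ} (hc : 0 ≤ c) (θ : ℝ) : ∀ n : ℕ,
    (pathPoly c n).eval (2 * √c * Real.cos θ) * Real.sin θ = √c ^ n * Real.sin ((n + 1 : ℕ) * θ)
  | 0 => by simp [pathPoly]
  | 1 => by
    simp [pathPoly, one_add_one_eq_two, Real.sin_two_mul]
    ring
  | n + 2 => by
    have h1 := eval_pathPoly_mul_sin hc θ (n + 1)
    have h2 := eval_pathPoly_mul_sin hc θ n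
    have e1 : ((n + 2 + 1 : ℕ) : ℝ) * θ = (n + 1 + 1 : ℕ) * θ + θ := by push_cast; ring
    have e2 : ((n + 1 : ℕ) : ℝ) * θ = (n + 1 + 1 : ℕ) * θ - θ := by push_cast; ring
    rw [e2, Real.sin_sub] at h2
    rw [eval_pathPoly_add_two, e1, Real.sin_add]
    have hs : √c ^ 2 = c := Real.sq_sqrt hc
    have e3 : √c ^ (n + 2) = c * √c ^ n := by rw [pow_add, hs]; ring
    have e4 : √c * √c ^ (n + 1) = c * √c ^ n := by
      rw [← pow_succ', pow_succ', pow_succ', ← mul_assoc, ← sq, hs]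
    linear_combination (2 * √c * Real.cos θ) * h1 - c * h2 +
      2 * Real.cos θ * Real.sin ((n + 1 + 1 : ℕ) * θ) * e4 -
      (Real.sin ((n + 1 + 1 : ℕ) * θ) * Real.cos θ +
        Real.cos ((n + 1 + 1 : ℕ) * θ) * Real.sin θ) * e3

/-- The normalized eigenvalue at the angle `π (1 - s)`. -/
noncomputable def nodeValue (k : ℕ) (s : ℝ) : ℝ :=
  (k - 2 * √((k : ℝ) - 1) * Real.cos (Real.pi * s)) / (2 * k)

theorem nodeValue_strictMonoOn {k : ℕ} (hk : 3 ≤ k) : StrictMonoOn (nodeValue k) (Icc 0 1) := by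
  have hk' : (3 : ℝ) ≤ k := by exact_mod_cast hk
  have hs : 0 < √((k : ℝ) - 1) := Real.sqrt_pos.2 (by linarith)
  intro s hs' t ht hst
  have : Real.cos (Real.pi * t) < Real.cos (Real.pi * s) :=
    Real.strictAntiOn_cos ⟨mul_nonneg Real.pi_pos.le hs'.1, by nlinarith [Real.pi_pos, hs'.2]⟩
      ⟨mul_nonneg Real.pi_pos.le ht.1, by nlinarith [Real.pi_pos, ht.2]⟩
      (mul_lt_mul_of_pos_left hst Real.pi_pos)
  unfold nodeValue
  gcongr

theorem continuous_nodeValue (k : ℕ) : Continuous (nodeValue k) := by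
  unfold nodeValue
  fun_prop

theorem natCast_div_mem_Icc {l n : ℕ} (h : l ≤ n) : (l / n : ℝ) ∈ Icc (0 : ℝ) 1 :=
  ⟨by positivity, div_le_one_of_le₀ (by exact_mod_cast h) (by positivity)⟩

theorem nodeValue_injOn {k : ℕ} (hk : 3 ≤ k) (n : ℕ) :
    Set.InjOn (fun l : ℕ => nodeValue k (l / n)) (Finset.Ioo 0 n) := by
  intro l hl m hm h
  simp only [Finset.coe_Ioo, Set.mem_Ioo] at hl hm
  have := (nodeValue_strictMonoOn hk).injOn (natCast_div_mem_Icc hl.2.le)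
    (natCast_div_mem_Icc hm.2.le) h
  have hn : (n : ℝ) ≠ 0 := by have := hl.1.trans hl.2; positivity
  field_simp at this
  exact_mod_cast this

/-- The angles `θ = π (1 - l / (n + 1))` annihilate `sin ((n + 1) θ)` but not `sin θ`. They give `n`
distinct roots, as many as the degree, so every root is simple. -/
theorem roots_pathPoly {k : ℕ} (hk : 3 ≤ k) (n : ℕ) :
    (pathPoly ((k : ℝ) - 1) n).roots =
      ((Finset.Ioo 0 (n + 1)).image
        fun l : ℕ => 2 * k * nodeValue k (l / (n + 1 : ℕ)) - k).val := by
  have hk' : (3 : ℝ) ≤ k := by exact_mod_cast hk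
  refine Polynomial.roots_eq_of_degree_eq_card (fun x hx ↦ ?_) ?_
  · obtain ⟨l, hl, rfl⟩ := Finset.mem_image.1 hx
    obtain ⟨hl0, hl1⟩ := Finset.mem_Ioo.1 hl
    set θ : ℝ := Real.pi - Real.pi * (l / (n + 1 : ℕ)) with hθ
    have hl1' : (l : ℝ) < (n + 1 : ℕ) := by exact_mod_cast hl1
    have hl0' : (0 : ℝ) < l := by exact_mod_cast hl0
    have hn : (0 : ℝ) < (n + 1 : ℕ) := by positivity
    have h1 : (l / (n + 1 : ℕ) : ℝ) < 1 := (div_lt_one hn).2 hl1'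
    have h0 : (0 : ℝ) < l / (n + 1 : ℕ) := div_pos hl0' hn
    have hsin : 0 < Real.sin θ := Real.sin_pos_of_pos_of_lt_pi
      (by rw [hθ]; nlinarith [Real.pi_pos]) (by rw [hθ]; nlinarith [Real.pi_pos])
    have hx : 2 * k * nodeValue k (l / (n + 1 : ℕ)) - k =
        2 * √((k : ℝ) - 1) * Real.cos θ := by
      rw [hθ, Real.cos_pi_sub, nodeValue]
      field_simp
      ring
    have := eval_pathPoly_mul_sin (c := (k : ℝ) - 1) (by linarith) θ n
    rw [show ((n + 1 : ℕ) : ℝ) * θ = ((n + 1 - l : ℤ) : ℝ) * Real.pi by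
      rw [hθ]; push_cast; push_cast at hn; field_simp, Real.sin_int_mul_pi, mul_zero] at this
    rw [hx]
    exact (mul_eq_zero.1 this).resolve_right hsin.ne'
  · rw [Polynomial.degree_eq_natDegree (pathPoly_ne_zero _ _),
      (pathPoly_monic_and_natDegree _ n).2, Finset.card_image_of_injOn, Nat.card_Ioo]
    · simp
    · intro l hl m hm h
      refine nodeValue_injOn hk (n + 1) hl hm ?_
      have h : 2 * k * nodeValue k (l / (n + 1 : ℕ)) - k =
        2 * k * nodeValue k (m / (n + 1 : ℕ)) - k := h
      have : (2 * k : ℝ) ≠ 0 := by positivity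
      exact mul_left_cancel₀ this (sub_left_injective h)

/-! ### Counting roots of the characteristic polynomial -/

open Classical in
/-- The number of `0 < l < n` for which the normalized eigenvalue at `l / n` lies in `E`. -/
noncomputable def nodeCount (k : ℕ) (E : Set ℝ) (n : ℕ) : ℕ :=
  ((Finset.Ioo 0 n).filter fun l : ℕ => nodeValue k (l / n) ∈ E).card

open Classical in
/-- The number of roots of `p` whose normalization lies in `E`. -/
noncomputable def rootCount (k : ℕ) (E : Set ℝ) (p : Polynomial ℝ) : ℕ :=
  p.roots.countP fun x : ℝ => (x + k) / (2 * k) ∈ E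

theorem rootCount_pathPoly {k : ℕ} (hk : 3 ≤ k) (E : Set ℝ) (n : ℕ) :
    rootCount k E (pathPoly ((k : ℝ) - 1) n) = nodeCount k E (n + 1) := by
  classical
  have hk' : (3 : ℝ) ≤ k := by exact_mod_cast hk
  rw [rootCount, roots_pathPoly hk, Multiset.countP_eq_card_filter, ← Finset.filter_val,
    Finset.card_val, Finset.filter_image, Finset.card_image_of_injOn, nodeCount]
  · congr 1
    refine Finset.filter_congr fun l _ => ?_
    rw [show (2 * k * nodeValue k (l / (n + 1 : ℕ)) - k + k) / (2 * k : ℝ) =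
      nodeValue k (l / (n + 1 : ℕ)) by field_simp; ring]
  · intro l hl m hm h
    refine nodeValue_injOn hk (n + 1) (Finset.mem_filter.1 hl).1 (Finset.mem_filter.1 hm).1 ?_
    have : (2 * k : ℝ) ≠ 0 := by positivity
    exact mul_left_cancel₀ this (sub_left_injective h)

theorem rootCount_mul (k : ℕ) (E : Set ℝ) {p q : Polynomial ℝ} (hp : p ≠ 0) (hq : q ≠ 0) :
    rootCount k E (p * q) = rootCount k E p + rootCount k E q := by
  rw [rootCount, Polynomial.roots_mul (mul_ne_zero hp hq), Multiset.countP_add]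
  rfl

theorem rootCount_prod_pow (k : ℕ) (E : Set ℝ) {ι : Type*} (s : Finset ι)
    (p : ι → Polynomial ℝ) (c : ι → ℕ) (hp : ∀ i, p i ≠ 0) :
    rootCount k E (∏ i ∈ s, p i ^ c i) = ∑ i ∈ s, c i * rootCount k E (p i) := by
  classical
  induction s using Finset.induction_on with
  | empty => simp [rootCount]
  | insert a s ha ih =>
    rw [Finset.prod_insert ha, Finset.sum_insert ha, rootCount_mul k E (pow_ne_zero _ (hp a))
      (Finset.prod_ne_zero_iff.2 fun i _ => pow_ne_zero _ (hp i)), ih, rootCount,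
      Polynomial.roots_pow, Multiset.countP_nsmul]
    rfl

theorem rootCount_charpoly (k n : ℕ) (E : Set ℝ) [DecidablePred (· ∈ E)] :
    rootCount k E ((regularSubtree k n).adjMatrix ℝ).charpoly =
      (Finset.univ.filter fun i => nSpec k n i ∈ E).card := by
  classical
  rw [rootCount, ((regularSubtree k n).isHermitian_adjMatrix ℝ).roots_charpoly_eq_eigenvalues,
    Multiset.countP_map, Finset.card_def, Finset.filter_val]
  congr!

/-- Inductively, `P_{n+2} - P_{n+1} = (x - 1) P_{n+1} - (k - 1) P_n ≥ (x - k) P_{n+1} > 0`. This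
keeps all pivots nonzero for `x > k`. -/
theorem eval_pathPoly_pos {k : ℕ} (hk : 3 ≤ k) {x : ℝ} (hx : (k : ℝ) < x) (n : ℕ) :
    0 < (pathPoly ((k : ℝ) - 1) n).eval x ∧
      (pathPoly ((k : ℝ) - 1) n).eval x ≤ (pathPoly ((k : ℝ) - 1) (n + 1)).eval x := by
  have hk' : (3 : ℝ) ≤ k := by exact_mod_cast hk
  induction n with
  | zero => simp [pathPoly]; linarith
  | succ n ih =>
    refine ⟨ih.1.trans_le ih.2, ?_⟩
    rw [eval_pathPoly_add_two]
    nlinarith [ih.1, ih.2]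

/-- The product of the pivots with denominators cleared. It suffices to compare values at the
infinitely many `x > k`, where elimination meets no zero pivot. -/
theorem charpoly_regularSubtree_mul {k : ℕ} (hk : 3 ≤ k) (n : ℕ) :
    ((regularSubtree k (n + 1)).adjMatrix ℝ).charpoly *
        (∏ d ∈ Finset.range (n + 1), pathPoly ((k : ℝ) - 1) (n - d) ^ (k * (k - 1) ^ d)) *
        pathPoly ((k : ℝ) - 1) (n + 1) =
      (Polynomial.X * pathPoly ((k : ℝ) - 1) (n + 1) -
          Polynomial.C (k : ℝ) * pathPoly ((k : ℝ) - 1) n) *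
        ∏ d ∈ Finset.range (n + 1), pathPoly ((k : ℝ) - 1) (n - d + 1) ^ (k * (k - 1) ^ d) := by
  have hk' : (3 : ℝ) ≤ k := by exact_mod_cast hk
  refine Polynomial.eq_of_infinite_eval_eq _ _ ((Ioi_infinite (k : ℝ)).mono fun x hx => ?_)
  have hx : (k : ℝ) < x := hx
  set y : ℕ → ℝ := fun j => (pathPoly ((k : ℝ) - 1) j).eval x with hy
  have hpos : ∀ j, 0 < y j := fun j => (eval_pathPoly_pos hk hx j).1
  have hle : ∀ j, y j ≤ y (j + 1) := fun j => (eval_pathPoly_pos hk hx j).2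
  have hrec : ∀ j, y (j + 2) = x * y (j + 1) - (k - 1) * y j :=
    fun j => eval_pathPoly_add_two _ _ _
  have hy0 : y 0 = 1 := by simp [hy, pathPoly]
  have hy1 : y 1 = x := by simp [hy, pathPoly]
  have hk1 : ((k - 1 : ℕ) : ℝ) = k - 1 := by rw [Nat.cast_sub (by omega)]; simp
  -- The root has `k` children rather than `k - 1`, hence its separate pivot. Beyond depth `n + 1`
  -- the truncated subtraction gives the harmless nonzero value `y 1 / y 0`.
  set δ : ℕ → ℝ := fun d => if d = 0 then (x * y (n + 1) - k * y n) / y (n + 1)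
    else y (n + 1 - d + 1) / y (n + 1 - d) with hδ
  have key := eval_charpoly_regularSubtree k (n + 1) x δ ?_ ?_ ?_
  · rw [Finset.prod_range_succ'] at key
    simp only [card_treeSphere_succ] at key
    have e1 : ∀ d ∈ Finset.range (n + 1), δ (d + 1) ^ (k * (k - 1) ^ d) =
        y (n - d + 1) ^ (k * (k - 1) ^ d) / y (n - d) ^ (k * (k - 1) ^ d) := by
      intro d _
      simp only [hδ, Nat.succ_ne_zero, if_false, div_pow, Nat.add_sub_add_right]
    rw [Finset.prod_congr rfl e1, Finset.prod_div_distrib] at key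
    have hne : ∏ d ∈ Finset.range (n + 1), y (n - d) ^ (k * (k - 1) ^ d) ≠ 0 :=
      Finset.prod_ne_zero_iff.2 fun d _ => pow_ne_zero _ (hpos _).ne'
    have hne1 := (hpos (n + 1)).ne'
    simp only [Set.mem_ofPred_eq, Polynomial.eval_mul, Polynomial.eval_prod, Polynomial.eval_pow,
      Polynomial.eval_sub, Polynomial.eval_X, Polynomial.eval_C, key]
    simp only [hδ, if_true, treeSphere, Finset.card_singleton, pow_one]
    change _ / (∏ d ∈ Finset.range (n + 1), y (n - d) ^ (k * (k - 1) ^ d)) *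
      ((x * y (n + 1) - k * y n) / y (n + 1)) *
      (∏ d ∈ Finset.range (n + 1), y (n - d) ^ (k * (k - 1) ^ d)) * y (n + 1) =
      (x * y (n + 1) - k * y n) * ∏ d ∈ Finset.range (n + 1), y (n - d + 1) ^ (k * (k - 1) ^ d)
    field_simp
  · intro d
    simp only [hδ]
    split_ifs
    · refine (div_pos ?_ (hpos _)).ne'
      nlinarith [hle n, hpos n, hpos (n + 1)]
    · exact (div_pos (hpos _) (hpos _)).ne'
  · simp [hδ, hy0, hy1]
  · intro d hd
    have hne := (hpos (n - d)).ne'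
    have hne1 := (hpos (n - d + 1)).ne'
    rcases Nat.eq_zero_or_pos d with rfl | hd0
    · simp only [hδ, if_true, zero_add, one_ne_zero, if_false, Nat.add_sub_cancel]
      simp only [Nat.sub_zero] at hne hne1
      field_simp
      ring
    · simp only [hδ, hd0.ne', if_false, Nat.succ_ne_zero, Nat.add_sub_add_right, hk1]
      rw [show n + 1 - d = n - d + 1 by omega, hrec]
      field_simp
      ring

/-- The factor coming from the root pivot enters only through its degree: `r` is linear in the depth
and disappears after division by the number of vertices. Terms are kept on both sides to avoid
subtraction of naturals. -/
theorem rootCount_charpoly_regularSubtree {k : ℕ} (hk : 3 ≤ k) (E : Set ℝ) (n : ℕ) :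
    ∃ r ≤ n + 2, rootCount k E ((regularSubtree k (n + 1)).adjMatrix ℝ).charpoly +
        ∑ d ∈ Finset.range (n + 1), k * (k - 1) ^ d * nodeCount k E (n - d + 1) +
        nodeCount k E (n + 2) =
      r + ∑ d ∈ Finset.range (n + 1), k * (k - 1) ^ d * nodeCount k E (n - d + 2) := by
  set Q := Polynomial.X * pathPoly ((k : ℝ) - 1) (n + 1) -
          Polynomial.C (k : ℝ) * pathPoly ((k : ℝ) - 1) n with hQ
  have hne := pathPoly_ne_zero ((k : ℝ) - 1)
  have h := charpoly_regularSubtree_mul hk n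
  have hA : ((regularSubtree k (n + 1)).adjMatrix ℝ).charpoly ≠ 0 :=
    (Matrix.charpoly_monic _).ne_zero
  have hp : ∀ f : ℕ → ℕ, ∏ d ∈ Finset.range (n + 1),
      pathPoly ((k : ℝ) - 1) (f d) ^ (k * (k - 1) ^ d) ≠ 0 :=
    fun f => Finset.prod_ne_zero_iff.2 fun d _ => pow_ne_zero _ (hne _)
  have hQ0 : Q ≠ 0 := by
    intro h0
    rw [← hQ, h0, zero_mul] at h
    exact mul_ne_zero (mul_ne_zero hA (hp _)) (hne _) h
  refine ⟨rootCount k E Q, ?_, ?_⟩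
  · classical
    refine (Multiset.countP_le_card _ _).trans ((Polynomial.card_roots' _).trans ?_)
    refine (Polynomial.natDegree_sub_le _ _).trans (max_le ?_ ?_)
    · refine Polynomial.natDegree_mul_le.trans ?_
      rw [(pathPoly_monic_and_natDegree _ _).2, Polynomial.natDegree_X]
      omega
    · refine (Polynomial.natDegree_C_mul_le _ _).trans ?_
      rw [(pathPoly_monic_and_natDegree _ _).2]
      omega
  · have h' := congrArg (rootCount k E) h
    rw [rootCount_mul k E (mul_ne_zero hA (hp _)) (hne _), rootCount_mul k E hA (hp _),
      rootCount_mul k E hQ0 (hp _), rootCount_prod_pow k E _ _ _ fun d => hne _,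
      rootCount_prod_pow k E _ _ _ fun d => hne _] at h'
    simpa only [rootCount_pathPoly hk] using h'

/-! ### The limiting proportion of eigenvalues in a set -/

theorem nodeCount_le (k : ℕ) (E : Set ℝ) (n : ℕ) : nodeCount k E n ≤ n := by
  classical exact (Finset.card_filter_le _ _).trans (by simp)

theorem nodeCount_zero (k : ℕ) (E : Set ℝ) : nodeCount k E 0 = 0 :=
  Nat.le_zero.1 (nodeCount_le k E 0)

theorem nodeCount_one (k : ℕ) (E : Set ℝ) : nodeCount k E 1 = 0 := by
  simp [nodeCount, show Finset.Ioo 0 1 = ∅ from rfl]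

theorem summable_nodeCount_div_pow {q : ℝ} (hq : 1 < q) (k : ℕ) (E : Set ℝ) :
    Summable fun n : ℕ => (nodeCount k E n : ℝ) / q ^ n := by
  have hq0 : 0 < q := by linarith
  have h : Summable fun n : ℕ => (n : ℝ) ^ 1 * q⁻¹ ^ n :=
    summable_pow_mul_geometric_of_norm_lt_one 1
      (by rw [Real.norm_of_nonneg (by positivity)]; exact inv_lt_one_of_one_lt₀ hq)
  refine Summable.of_nonneg_of_le (fun n => by positivity) (fun n => ?_) h
  rw [pow_one, inv_pow, ← div_eq_mul_inv]
  have : (nodeCount k E n : ℝ) ≤ n := by exact_mod_cast nodeCount_le k E n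
  gcongr

/-- Summation by parts. Since the counts at 0 and 1 vanish, both shifted series equal the same sum
`A`, and `(q - 1) q A - (q - 1) A = (q - 1)² A`. -/
theorem hasSum_nodeCount_sub {q : ℝ} (hq : 1 < q) (k : ℕ) (E : Set ℝ) :
    HasSum (fun h : ℕ => (q - 1) / q ^ (h + 1) *
        ((nodeCount k E (h + 2) : ℝ) - nodeCount k E (h + 1)))
      (∑' n : ℕ, (q - 1) ^ 2 / q ^ n * (nodeCount k E n : ℝ)) := by
  have hq0 : q ≠ 0 := by linarith
  have hs := (summable_nodeCount_div_pow hq k E).hasSum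
  set A := ∑' n : ℕ, (nodeCount k E n : ℝ) / q ^ n with hA
  have h1 : HasSum (fun h : ℕ => (nodeCount k E (h + 1) : ℝ) / q ^ (h + 1)) A := by
    have := (hasSum_nat_add_iff' 1).2 hs
    simpa [nodeCount_zero] using this
  have h2 : HasSum (fun h : ℕ => (nodeCount k E (h + 2) : ℝ) / q ^ (h + 2)) A := by
    have := (hasSum_nat_add_iff' 2).2 hs
    simpa [nodeCount_zero, nodeCount_one, Finset.sum_range_succ] using this
  have h3 : ∑' n : ℕ, (q - 1) ^ 2 / q ^ n * (nodeCount k E n : ℝ) = (q - 1) ^ 2 * A := by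
    rw [hA, ← tsum_mul_left]
    exact tsum_congr fun n => by ring
  rw [h3, show (q - 1) ^ 2 * A = ((q - 1) * q) * A - (q - 1) * A by ring]
  refine (congrArg (fun f : ℕ → ℝ => HasSum f _) (funext fun h => ?_)).mpr
    ((h2.mul_left ((q - 1) * q)).sub (h1.mul_left (q - 1)))
  field_simp
  ring

theorem cast_card_treeBall_mul {k : ℕ} (hk : 3 ≤ k) (n : ℕ) :
    ((treeBall k n).card : ℝ) * (k - 2) = k * (k - 1) ^ n - 2 := by
  have hk1 : ((k - 1 : ℕ) : ℝ) = k - 1 := by rw [Nat.cast_sub (by omega)]; simp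
  rw [card_treeBall]
  push_cast
  rw [hk1, ← Finset.mul_sum]
  have := geom_sum_mul ((k : ℝ) - 1) n
  linear_combination k * this

theorem pow_le_card_treeBall {k : ℕ} (hk : 3 ≤ k) (n : ℕ) :
    (k : ℝ) * (k - 1) ^ n ≤ (treeBall k (n + 1)).card := by
  have hk1 : ((k - 1 : ℕ) : ℝ) = k - 1 := by rw [Nat.cast_sub (by omega)]; simp
  have hk' : (3 : ℝ) ≤ k := by exact_mod_cast hk
  rw [card_treeBall, Finset.sum_range_succ]
  push_cast
  rw [hk1]
  have : 0 ≤ ∑ d ∈ Finset.range n, (k : ℝ) * (k - 1) ^ d :=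
    Finset.sum_nonneg fun d _ => by have : (0 : ℝ) ≤ k - 1 := by linarith
                                    positivity
  linarith

theorem tendsto_pow_div_card_treeBall {k : ℕ} (hk : 3 ≤ k) (h : ℕ) :
    Tendsto (fun n : ℕ => (k : ℝ) * (k - 1) ^ (n - h) / (treeBall k (n + 1)).card) atTop
      (𝓝 (((k : ℝ) - 1 - 1) / (k - 1) ^ (h + 1))) := by
  have hk' : (3 : ℝ) ≤ k := by exact_mod_cast hk
  have hq : (1 : ℝ) < k - 1 := by linarith
  set q : ℝ := k - 1 with hqd
  have hq0 : (0 : ℝ) < q := by linarith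
  have hk0 : (k : ℝ) ≠ 0 := by linarith
  have hlim : Tendsto
      (fun n : ℕ => (k : ℝ) * (q - 1) / q ^ (h + 1) / (k - 2 * (q ^ (n + 1))⁻¹)) atTop
      (𝓝 ((k : ℝ) * (q - 1) / q ^ (h + 1) / (k - 2 * 0))) := by
    refine Tendsto.div tendsto_const_nhds (tendsto_const_nhds.sub (Tendsto.const_mul _ ?_))
      (by simp; omega)
    exact (tendsto_inv_atTop_zero.comp (tendsto_pow_atTop_atTop_of_one_lt hq)).comp
      (tendsto_add_atTop_nat 1)
  rw [show (k : ℝ) * (q - 1) / q ^ (h + 1) / (k - 2 * 0) = (q - 1) / q ^ (h + 1) by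
    rw [mul_zero, sub_zero, div_right_comm, mul_div_cancel_left₀ _ hk0]] at hlim
  refine hlim.congr' ?_
  filter_upwards [eventually_ge_atTop h] with n hn
  have hN := cast_card_treeBall_mul hk (n + 1)
  have hNpos : (0 : ℝ) < (treeBall k (n + 1)).card :=
    lt_of_lt_of_le (by positivity) (pow_le_card_treeBall hk n)
  rw [show (k : ℝ) - 2 = q - 1 by rw [hqd]; ring, ← hqd] at hN
  have hq1 : 0 < q - 1 := by linarith
  have e : (k : ℝ) - 2 * (q ^ (n + 1))⁻¹ = (treeBall k (n + 1)).card * (q - 1) / q ^ (n + 1) := by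
    rw [hN]; field_simp
  have e2 : q ^ (n + 1) = q ^ (h + 1) * q ^ (n - h) := by
    rw [← pow_add]; congr 1; omega
  rw [e, e2]
  field_simp

theorem tendsto_rootCount_div_card {k : ℕ} (hk : 3 ≤ k) (E : Set ℝ) :
    Tendsto (fun n : ℕ => (rootCount k E ((regularSubtree k (n + 1)).adjMatrix ℝ).charpoly : ℝ) /
        (treeBall k (n + 1)).card) atTop
      (𝓝 (∑' n : ℕ, ((k : ℝ) - 2) ^ 2 / (k - 1) ^ n * (nodeCount k E n : ℝ))) := by
  have hk' : (3 : ℝ) ≤ k := by exact_mod_cast hk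
  have hk1 : ((k - 1 : ℕ) : ℝ) = k - 1 := by rw [Nat.cast_sub (by omega)]; simp
  have hq : (1 : ℝ) < k - 1 := by linarith
  have hq0 : (0 : ℝ) < (k : ℝ) - 1 := by linarith
  have hk0 : (0 : ℝ) < k := by linarith
  set N : ℕ → ℝ := fun n => (treeBall k (n + 1)).card with hNdef
  have hNle : ∀ n, (k : ℝ) * (k - 1) ^ n ≤ N n := pow_le_card_treeBall hk
  have hNpos : ∀ n, 0 < N n := fun n => lt_of_lt_of_le (by positivity) (hNle n)
  set D : ℕ → ℝ := fun h => (nodeCount k E (h + 2) : ℝ) - nodeCount k E (h + 1) with hD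
  have hDle : ∀ h, |D h| ≤ h + 2 := by
    intro h
    have h1 : (nodeCount k E (h + 2) : ℝ) ≤ h + 2 := by exact_mod_cast nodeCount_le k E (h + 2)
    have h2 : (nodeCount k E (h + 1) : ℝ) ≤ h + 1 := by exact_mod_cast nodeCount_le k E (h + 1)
    have h3 : (0 : ℝ) ≤ nodeCount k E (h + 2) := by positivity
    have h4 : (0 : ℝ) ≤ nodeCount k E (h + 1) := by positivity
    rw [abs_le]
    constructor <;> simp only [hD] <;> linarith
  choose r hr hcount using rootCount_charpoly_regularSubtree hk E
  have hlin : Tendsto (fun n : ℕ => ((n : ℝ) + 2) / N n) atTop (𝓝 0) := by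
    have h0 : Tendsto (fun n : ℕ => ((n : ℝ) ^ 1 * ((k : ℝ) - 1)⁻¹ ^ n + 2 * ((k : ℝ) - 1)⁻¹ ^ n))
        atTop (𝓝 (0 + 2 * 0)) := by
      have habs : |((k : ℝ) - 1)⁻¹| < 1 := by
        rw [abs_of_pos (by positivity)]; exact inv_lt_one_of_one_lt₀ hq
      exact (tendsto_pow_const_mul_const_pow_of_abs_lt_one 1 habs).add
        ((tendsto_pow_atTop_nhds_zero_of_abs_lt_one habs).const_mul 2)
    rw [mul_zero, add_zero] at h0
    refine squeeze_zero (fun n => by have := hNpos n; positivity) (fun n => ?_) h0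
    rw [div_le_iff₀ (hNpos n)]
    have : ((n : ℝ) + 2) = ((n : ℝ) ^ 1 * ((k : ℝ) - 1)⁻¹ ^ n + 2 * ((k : ℝ) - 1)⁻¹ ^ n) *
        (k - 1) ^ n := by
      rw [inv_pow]; field_simp
    rw [this]
    gcongr
    refine le_trans ?_ (hNle n)
    have : (0 : ℝ) < ((k : ℝ) - 1) ^ n := by positivity
    nlinarith
  have hr0 : Tendsto (fun n : ℕ => (r n : ℝ) / N n) atTop (𝓝 0) := by
    refine squeeze_zero (fun n => by have := hNpos n; positivity) (fun n => ?_) hlin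
    have : (r n : ℝ) ≤ n + 2 := by exact_mod_cast hr n
    have := hNpos n
    gcongr
  have hc0 : Tendsto (fun n : ℕ => (nodeCount k E (n + 2) : ℝ) / N n) atTop (𝓝 0) := by
    refine squeeze_zero (fun n => by have := hNpos n; positivity) (fun n => ?_) hlin
    have : (nodeCount k E (n + 2) : ℝ) ≤ n + 2 := by exact_mod_cast nodeCount_le k E (n + 2)
    have := hNpos n
    gcongr
  -- Indexing by the height `h = n - d` above the leaves makes each term converge as `n → ∞`; the
  -- terms are dominated by `(h + 2) / (k - 1) ^ h`.
  have hmain : Tendsto (fun n : ℕ => ∑' h : ℕ, if h < n + 1 then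
      (k : ℝ) * (k - 1) ^ (n - h) / N n * D h else 0) atTop
      (𝓝 (∑' h : ℕ, ((k : ℝ) - 1 - 1) / (k - 1) ^ (h + 1) * D h)) := by
    refine tendsto_tsum_of_dominated_convergence
      (bound := fun h : ℕ => ((h : ℝ) ^ 1 * ((k : ℝ) - 1)⁻¹ ^ h + 2 * ((k : ℝ) - 1)⁻¹ ^ h)) ?_ ?_ ?_
    · have hn : ‖((k : ℝ) - 1)⁻¹‖ < 1 := by
        rw [Real.norm_of_nonneg (by positivity)]; exact inv_lt_one_of_one_lt₀ hq
      exact (summable_pow_mul_geometric_of_norm_lt_one 1 hn).add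
        ((summable_geometric_of_norm_lt_one hn).mul_left 2)
    · intro h
      refine ((tendsto_pow_div_card_treeBall hk h).mul_const (D h)).congr' ?_
      filter_upwards [eventually_ge_atTop h] with n hn
      rw [if_pos (by omega)]
    · refine Eventually.of_forall fun n h => ?_
      split_ifs with hlt
      · rw [norm_mul, Real.norm_of_nonneg (by have := hNpos n; positivity), Real.norm_eq_abs]
        have e : (k : ℝ) * (k - 1) ^ (n - h) / N n ≤ ((k : ℝ) - 1)⁻¹ ^ h := by
          rw [div_le_iff₀ (hNpos n)]
          calc (k : ℝ) * (k - 1) ^ (n - h) = ((k : ℝ) - 1)⁻¹ ^ h * (k * (k - 1) ^ n) := by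
                rw [show ((k : ℝ) - 1) ^ n = (k - 1) ^ h * (k - 1) ^ (n - h) by
                  rw [← pow_add]; congr 1; omega, inv_pow]
                field_simp
            _ ≤ _ := by gcongr; exact hNle n
        calc _ ≤ ((k : ℝ) - 1)⁻¹ ^ h * (h + 2) := by
              gcongr
              exact hDle h
          _ = _ := by ring
      · rw [norm_zero]; positivity
  have hsum := (hasSum_nodeCount_sub hq k E).tsum_eq
  rw [hsum, show (k : ℝ) - 1 - 1 = k - 2 by ring] at hmain
  have := (hr0.sub hc0).add hmain
  rw [sub_zero, zero_add] at this
  refine this.congr fun n => ?_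
  have hfin : (∑' h : ℕ, if h < n + 1 then (k : ℝ) * (k - 1) ^ (n - h) / N n * D h else 0) =
      (∑ d ∈ Finset.range (n + 1), (k : ℝ) * (k - 1) ^ d *
        ((nodeCount k E (n - d + 2) : ℝ) - nodeCount k E (n - d + 1))) / N n := by
    rw [tsum_eq_sum (s := Finset.range (n + 1))
      (fun h hh => if_neg (by simpa using hh)), ← Finset.sum_range_reflect, Finset.sum_div]
    refine Finset.sum_congr rfl fun d hd => ?_
    have hd := Finset.mem_range.1 hd
    rw [if_pos (by omega), show n + 1 - 1 - d = n - d by omega, show n - (n - d) = d by omega]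
    ring
  have hc := congrArg (Nat.cast (R := ℝ)) (hcount n)
  push_cast at hc
  rw [hk1] at hc
  rw [hfin, ← sub_div, ← add_div]
  congr 1
  simp only [mul_sub, Finset.sum_sub_distrib]
  linarith

/-! ### The limit measure -/

/-- The limit of the normalized spectral distributions: a mass `(k - 2)² / (k - 1)ⁿ` at each of
the `n - 1` normalized eigenvalues of the path with `n - 1` vertices. -/
noncomputable def limitMeasure (k : ℕ) : Measure ℝ :=
  Measure.sum fun n : ℕ => ENNReal.ofReal (((k : ℝ) - 2) ^ 2 / (k - 1) ^ n) •
    ∑ l ∈ Finset.Ioo 0 n, Measure.dirac (nodeValue k (l / n))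

theorem sum_dirac_nodeValue (k n : ℕ) {E : Set ℝ} (hE : MeasurableSet E) :
    (∑ l ∈ Finset.Ioo 0 n, Measure.dirac (nodeValue k (l / n))) E = nodeCount k E n := by
  classical
  simp [Measure.dirac_apply' _ hE, nodeCount, Set.indicator_apply, Finset.sum_boole]

theorem limitMeasure_apply (k : ℕ) {E : Set ℝ} (hE : MeasurableSet E) :
    limitMeasure k E = ∑' n : ℕ, ENNReal.ofReal (((k : ℝ) - 2) ^ 2 / (k - 1) ^ n) *
      nodeCount k E n := by
  simp [limitMeasure, Measure.sum_apply _ hE, ← sum_dirac_nodeValue k _ hE]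

theorem limitMeasure_real {k : ℕ} (hk : 3 ≤ k) {E : Set ℝ} (hE : MeasurableSet E) :
    limitMeasure k E = ENNReal.ofReal
      (∑' n : ℕ, ((k : ℝ) - 2) ^ 2 / (k - 1) ^ n * (nodeCount k E n : ℝ)) := by
  have hk' : (3 : ℝ) ≤ k := by exact_mod_cast hk
  have hq0 : (0 : ℝ) < (k : ℝ) - 1 := by linarith
  rw [limitMeasure_apply k hE, ENNReal.ofReal_tsum_of_nonneg]
  · refine tsum_congr fun n => ?_
    rw [ENNReal.ofReal_mul (by positivity), ENNReal.ofReal_natCast]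
  · intro n
    positivity
  · refine ((summable_nodeCount_div_pow (q := (k : ℝ) - 1) (by linarith) k E).mul_left
      (((k : ℝ) - 2) ^ 2)).congr
      fun n => ?_
    ring

theorem nodeCount_univ (k n : ℕ) : nodeCount k univ n = n - 1 := by
  simp [nodeCount]

theorem isProbabilityMeasure_limitMeasure {k : ℕ} (hk : 3 ≤ k) :
    IsProbabilityMeasure (limitMeasure k) := by
  have hk' : (3 : ℝ) ≤ k := by exact_mod_cast hk
  have hq0 : (0 : ℝ) < (k : ℝ) - 1 := by linarith
  have hq2 : (0 : ℝ) < (k : ℝ) - 2 := by linarith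
  refine ⟨?_⟩
  rw [limitMeasure_real hk MeasurableSet.univ]
  have hn : ‖((k : ℝ) - 1)⁻¹‖ < 1 := by
    rw [Real.norm_of_nonneg (by positivity)]; exact inv_lt_one_of_one_lt₀ (by linarith)
  have h := (hasSum_coe_mul_geometric_of_norm_lt_one hn).mul_left
    (((k : ℝ) - 2) ^ 2 * ((k : ℝ) - 1)⁻¹)
  have h' : HasSum (fun n : ℕ => ((k : ℝ) - 2) ^ 2 / (k - 1) ^ n * (nodeCount k univ n : ℝ))
      (((k : ℝ) - 2) ^ 2 * ((k : ℝ) - 1)⁻¹ * (((k : ℝ) - 1)⁻¹ / (1 - ((k : ℝ) - 1)⁻¹) ^ 2)) := by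
    refine (hasSum_nat_add_iff' 1).1 ?_
    simp only [Finset.sum_range_one, nodeCount_univ, zero_tsub, Nat.cast_zero, mul_zero, sub_zero,
      Nat.add_sub_cancel]
    refine (congrArg (fun f : ℕ → ℝ => HasSum f _) (funext fun n => ?_)).mpr h
    rw [inv_pow]
    field_simp
    ring
  rw [h'.tsum_eq, ENNReal.ofReal_eq_one]
  have : (1 : ℝ) - ((k : ℝ) - 1)⁻¹ = (k - 2) / (k - 1) := by field_simp; ring
  rw [this]
  field_simp

/-! ### Regrouping by reduced fractions; the atoms -/

open Classical in
/-- The number of `0 < l < n` prime to `n` for which the normalized eigenvalue at `l / n` lies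
in `E`. -/
noncomputable def coprimeNodeCount (k : ℕ) (E : Set ℝ) (n : ℕ) : ℕ :=
  ((Finset.Ioo 0 n).filter fun l : ℕ => Nat.Coprime l n ∧ nodeValue k (l / n) ∈ E).card

/-- Each fraction `l / n` has a unique reduced form, whose denominator divides `n`. -/
theorem nodeCount_eq_sum_divisors (k : ℕ) (E : Set ℝ) (n : ℕ) :
    nodeCount k E n = ∑ m ∈ n.divisors, coprimeNodeCount k E m := by
  classical
  simp only [nodeCount, coprimeNodeCount]
  rw [← Finset.card_sigma]
  refine Finset.card_bij' (fun l _ => ⟨n / Nat.gcd l n, l / Nat.gcd l n⟩)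
    (fun p _ => p.2 * (n / p.1)) ?_ ?_ ?_ ?_
  · intro l hl
    obtain ⟨hl, hE⟩ := Finset.mem_filter.1 hl
    obtain ⟨h0, h1⟩ := Finset.mem_Ioo.1 hl
    have hg : 0 < Nat.gcd l n := Nat.gcd_pos_of_pos_left _ h0
    have hdn := Nat.gcd_dvd_right l n
    have hdl := Nat.gcd_dvd_left l n
    refine Finset.mem_sigma.2 ⟨Nat.mem_divisors.2 ⟨Nat.div_dvd_of_dvd hdn, by omega⟩,
      Finset.mem_filter.2 ⟨Finset.mem_Ioo.2 ⟨Nat.div_pos (Nat.le_of_dvd h0 hdl) hg,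
        Nat.div_lt_div_of_lt_of_dvd hdn h1⟩, Nat.coprime_div_gcd_div_gcd hg, ?_⟩⟩
    have hg' : ((Nat.gcd l n : ℕ) : ℝ) ≠ 0 := by exact_mod_cast hg.ne'
    simp only
    rwa [Nat.cast_div hdl hg', Nat.cast_div hdn hg', div_div_div_cancel_right₀ hg']
  · rintro ⟨m, l⟩ h
    obtain ⟨hm, h⟩ := Finset.mem_sigma.1 h
    obtain ⟨hl, hc, hE⟩ := Finset.mem_filter.1 h
    obtain ⟨h0, h1⟩ := Finset.mem_Ioo.1 hl
    obtain ⟨⟨d, rfl⟩, hn⟩ := Nat.mem_divisors.1 hm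
    simp only at *
    have hm0 : 0 < m := h0.trans h1
    have hd0 : 0 < d := Nat.pos_of_ne_zero fun h => hn (by simp [h])
    rw [Nat.mul_div_cancel_left _ hm0]
    refine Finset.mem_filter.2 ⟨Finset.mem_Ioo.2 ⟨by positivity, by gcongr⟩, ?_⟩
    push_cast
    rwa [mul_div_mul_right _ _ (by exact_mod_cast hd0.ne')]
  · intro l hl
    obtain ⟨hl, hE⟩ := Finset.mem_filter.1 hl
    obtain ⟨h0, h1⟩ := Finset.mem_Ioo.1 hl
    have hdn := Nat.gcd_dvd_right l n
    simp only
    rw [Nat.div_div_self hdn (by omega), Nat.div_mul_cancel (Nat.gcd_dvd_left l n)]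
  · rintro ⟨m, l⟩ h
    obtain ⟨hm, h⟩ := Finset.mem_sigma.1 h
    obtain ⟨hl, hc, hE⟩ := Finset.mem_filter.1 h
    obtain ⟨h0, h1⟩ := Finset.mem_Ioo.1 hl
    obtain ⟨⟨d, rfl⟩, hn⟩ := Nat.mem_divisors.1 hm
    simp only at *
    have hm0 : 0 < m := h0.trans h1
    have hd0 : 0 < d := Nat.pos_of_ne_zero fun h => hn (by simp [h])
    rw [Nat.mul_div_cancel_left _ hm0, Nat.gcd_mul_right, hc.gcd_eq_one, one_mul,
      Nat.mul_div_cancel _ hd0, Nat.mul_div_cancel _ hd0]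

theorem tsum_multiples_eq_stairWidth {k : ℕ} (hk : 3 ≤ k) {m : ℕ} (hm : m ≠ 0) :
    ∑' n : ℕ, (if m ∈ n.divisors then ENNReal.ofReal (((k : ℝ) - 2) ^ 2 / (k - 1) ^ n) else 0) =
      ENNReal.ofReal (stairWidth k m) := by
  have hk' : (3 : ℝ) ≤ k := by exact_mod_cast hk
  have hq0 : (0 : ℝ) < (k : ℝ) - 1 := by linarith
  have hm0 := Nat.pos_of_ne_zero hm
  have hinj : Function.Injective fun r : ℕ => m * (r + 1) := fun a b h => by
    simpa [hm] using h
  have hQ : (1 : ℝ) < ((k : ℝ) - 1) ^ m := one_lt_pow₀ (by linarith) hm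
  rw [← hinj.tsum_eq]
  · have h1 : ∀ r : ℕ, (if m ∈ (m * (r + 1)).divisors then
        ENNReal.ofReal (((k : ℝ) - 2) ^ 2 / (k - 1) ^ (m * (r + 1))) else 0) =
        ENNReal.ofReal (((k : ℝ) - 2) ^ 2 / (k - 1) ^ m * ((((k : ℝ) - 1) ^ m)⁻¹) ^ r) := by
      intro r
      rw [if_pos (Nat.mem_divisors.2 ⟨dvd_mul_right _ _, by positivity⟩), inv_pow, ← pow_mul,
        mul_add, mul_one, pow_add]
      congr 1
      field_simp
    rw [tsum_congr h1]
    have hgeo := (hasSum_geometric_of_lt_one (r := (((k : ℝ) - 1) ^ m)⁻¹) (by positivity)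
      (inv_lt_one_of_one_lt₀ hQ)).mul_left (((k : ℝ) - 2) ^ 2 / (k - 1) ^ m)
    rw [← ENNReal.ofReal_tsum_of_nonneg (fun r => by positivity) hgeo.summable, hgeo.tsum_eq]
    congr 1
    have : ((k : ℝ) - 1) ^ m - 1 ≠ 0 := by linarith
    rw [stairWidth]
    field_simp
  -- `Nat.divisors 0` is empty, so the term `n = 0` drops out and only the multiples `m (r + 1)`
  -- contribute.
  · intro n hn
    rw [Function.mem_support, ne_eq, ite_eq_right_iff, not_forall] at hn
    obtain ⟨⟨d, rfl⟩, h0⟩ := Nat.mem_divisors.1 hn.1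
    refine ⟨d - 1, ?_⟩
    have : d ≠ 0 := fun h => h0 (by simp [h])
    simp only
    rw [Nat.sub_add_cancel (by omega)]

theorem coprimeNodeCount_eq_zero {k : ℕ} {E : Set ℝ} {n : ℕ}
    (h : ∀ l : ℕ, 0 < l → l < n → Nat.Coprime l n → nodeValue k (l / n) ∉ E) :
    coprimeNodeCount k E n = 0 := by
  classical
  refine Finset.card_eq_zero.2 (Finset.filter_eq_empty_iff.2 fun l hl hl' => ?_)
  obtain ⟨h0, h1⟩ := Finset.mem_Ioo.1 hl
  exact h l h0 h1 hl'.1 hl'.2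

theorem coprimeNodeCount_zero (k : ℕ) (E : Set ℝ) : coprimeNodeCount k E 0 = 0 := by
  simp [coprimeNodeCount]

theorem stairWidth_nonneg {k : ℕ} (hk : 3 ≤ k) (m : ℕ) : 0 ≤ stairWidth k m := by
  have hk' : (3 : ℝ) ≤ k := by exact_mod_cast hk
  have : (1 : ℝ) ≤ ((k : ℝ) - 1) ^ m := one_le_pow₀ (by linarith)
  exact div_nonneg (sq_nonneg _) (by linarith)

theorem stairWidth_pos {k : ℕ} (hk : 3 ≤ k) {m : ℕ} (hm : m ≠ 0) : 0 < stairWidth k m := by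
  have hk' : (3 : ℝ) ≤ k := by exact_mod_cast hk
  have : (1 : ℝ) < ((k : ℝ) - 1) ^ m := one_lt_pow₀ (by linarith) hm
  exact div_pos (pow_pos (by linarith) _) (by linarith)

theorem limitMeasure_eq_tsum_stairWidth {k : ℕ} (hk : 3 ≤ k) {E : Set ℝ} (hE : MeasurableSet E) :
    limitMeasure k E = ∑' m : ℕ, ENNReal.ofReal (stairWidth k m * coprimeNodeCount k E m) := by
  rw [limitMeasure_apply k hE]
  have h1 : ∀ n : ℕ, ENNReal.ofReal (((k : ℝ) - 2) ^ 2 / (k - 1) ^ n) * (nodeCount k E n : ℝ≥0∞) =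
      ∑' m : ℕ, (if m ∈ n.divisors then ENNReal.ofReal (((k : ℝ) - 2) ^ 2 / (k - 1) ^ n) else 0) *
        (coprimeNodeCount k E m : ℝ≥0∞) := by
    intro n
    rw [nodeCount_eq_sum_divisors, Nat.cast_sum, Finset.mul_sum,
      tsum_eq_sum (s := n.divisors) fun m hm => by rw [if_neg hm, zero_mul]]
    exact Finset.sum_congr rfl fun m hm => by rw [if_pos hm]
  rw [tsum_congr h1, ENNReal.tsum_comm]
  refine tsum_congr fun m => ?_
  rw [ENNReal.tsum_mul_right, ENNReal.ofReal_mul (stairWidth_nonneg hk m), ENNReal.ofReal_natCast]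
  rcases eq_or_ne m 0 with rfl | hm
  · simp [coprimeNodeCount_zero]
  · rw [tsum_multiples_eq_stairWidth hk hm]

theorem hasSum_stairWidth_mul_coprimeNodeCount {k : ℕ} (hk : 3 ≤ k) {E : Set ℝ}
    (hE : MeasurableSet E) :
    HasSum (fun n : ℕ => stairWidth k (n + 1) * (coprimeNodeCount k E (n + 1) : ℝ))
      ((limitMeasure k).real E) := by
  have := isProbabilityMeasure_limitMeasure hk
  have h := limitMeasure_eq_tsum_stairWidth hk hE
  have hne : ∑' m : ℕ, ENNReal.ofReal (stairWidth k m * coprimeNodeCount k E m) ≠ ⊤ :=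
    h ▸ measure_ne_top _ _
  have hs := ENNReal.hasSum_toReal hne
  rw [← ENNReal.tsum_toReal_eq (fun m => ENNReal.ofReal_ne_top), ← h] at hs
  have h0 : ∀ m : ℕ, 0 ≤ stairWidth k m * coprimeNodeCount k E m := fun m =>
    mul_nonneg (stairWidth_nonneg hk m) (Nat.cast_nonneg _)
  simp only [ENNReal.toReal_ofReal (h0 _)] at hs
  simpa [coprimeNodeCount_zero, Measure.real] using (hasSum_nat_add_iff' 1).2 hs

/-- The normalized eigenvalues of all paths. -/
def nodeSet (k : ℕ) : Set ℝ :=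
  {x | ∃ a m : ℕ, 0 < a ∧ a < m ∧ Nat.Coprime a m ∧ x = nodeValue k (a / m)}

theorem countable_nodeSet (k : ℕ) : (nodeSet k).Countable := by
  refine (countable_range fun p : ℕ × ℕ => nodeValue k (p.1 / p.2)).mono ?_
  rintro x ⟨a, m, -, -, -, rfl⟩
  exact ⟨(a, m), rfl⟩

theorem limitMeasure_compl_nodeSet {k : ℕ} (hk : 3 ≤ k) : limitMeasure k (nodeSet k)ᶜ = 0 := by
  rw [limitMeasure_eq_tsum_stairWidth hk (countable_nodeSet k).measurableSet.compl,
    ENNReal.tsum_eq_zero]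
  intro m
  have h0 : coprimeNodeCount k (nodeSet k)ᶜ m = 0 :=
    coprimeNodeCount_eq_zero fun l h0 h1 hc h => h ⟨l, m, h0, h1, hc, rfl⟩
  rw [h0, Nat.cast_zero, mul_zero, ENNReal.ofReal_zero]

theorem coprimeNodeCount_Iio {k : ℕ} (hk : 3 ≤ k) {a m : ℕ} (ham : a < m) (n : ℕ) :
    coprimeNodeCount k (Iio (nodeValue k (a / m))) (n + 1) = coprimeCount a m (n + 1) := by
  rw [coprimeNodeCount, coprimeCount]
  congr 1
  ext l
  simp only [Finset.mem_filter, Finset.mem_Ioo, Finset.mem_Icc, Set.mem_Iio]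
  have hm : (0 : ℚ) < m := by exact_mod_cast (by omega : 0 < m)
  have key : ∀ h : l < n + 1, (nodeValue k (l / (n + 1 : ℕ)) < nodeValue k (a / m) ↔
      (l : ℚ) < a * (n + 1 : ℕ) / m) := by
    intro h
    rw [(nodeValue_strictMonoOn hk).lt_iff_lt (natCast_div_mem_Icc h.le)
      (natCast_div_mem_Icc ham.le), div_lt_div_iff₀ (by positivity) (by exact_mod_cast hm),
      lt_div_iff₀ hm]
    norm_cast
  constructor
  · rintro ⟨⟨h0, h1⟩, hc, h⟩
    exact ⟨⟨h0, h1.le⟩, hc, (key h1).1 h⟩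
  · rintro ⟨⟨h0, h1⟩, hc, h⟩
    -- The endpoint `l = n + 1`, allowed in `coprimeCount`, is excluded because `a (n + 1) / m ≤ n +
    -- 1`.
    have h2 : l < n + 1 := by
      have h3 : (a : ℚ) * (n + 1 : ℕ) / m ≤ (n + 1 : ℕ) := by
        rw [div_le_iff₀ hm, mul_comm]
        have : (a : ℚ) ≤ m := by exact_mod_cast ham.le
        gcongr
      exact_mod_cast h.trans_le h3
    exact ⟨⟨h0, h2⟩, hc, (key h2).2 h⟩

theorem coprimeNodeCount_singleton {k : ℕ} (hk : 3 ≤ k) {a m : ℕ} (ha : 0 < a) (ham : a < m)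
    (hc : Nat.Coprime a m) (n : ℕ) :
    coprimeNodeCount k {nodeValue k (a / m)} n = if n = m then 1 else 0 := by
  have key : ∀ l : ℕ, 0 < l → l < n → Nat.Coprime l n →
      nodeValue k (l / n) ∈ ({nodeValue k (a / m)} : Set ℝ) → l = a ∧ n = m := by
    intro l h0 h1 hl h
    have := (nodeValue_strictMonoOn hk).injOn (natCast_div_mem_Icc h1.le)
      (natCast_div_mem_Icc ham.le) h
    have hn : (n : ℝ) ≠ 0 := by have := h0.trans h1; positivity
    have hm : (m : ℝ) ≠ 0 := by have := ha.trans ham; positivity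
    rw [div_eq_div_iff hn hm] at this
    have e : l * m = a * n := by exact_mod_cast this
    have e1 : n ∣ m := hl.symm.dvd_of_dvd_mul_left (e ▸ dvd_mul_left n a)
    have e2 : m ∣ n := hc.symm.dvd_of_dvd_mul_left (e ▸ dvd_mul_left m l)
    obtain rfl := Nat.dvd_antisymm e1 e2
    exact ⟨Nat.eq_of_mul_eq_mul_right (h0.trans h1) e, rfl⟩
  rw [coprimeNodeCount]
  split_ifs with h
  · subst h
    refine Finset.card_eq_one.2 ⟨a, ?_⟩
    ext l
    simp only [Finset.mem_filter, Finset.mem_Ioo, Finset.mem_singleton]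
    constructor
    · rintro ⟨⟨h0, h1⟩, hl, h⟩
      exact (key l h0 h1 hl h).1
    · rintro rfl
      exact ⟨⟨ha, ham⟩, hc, rfl⟩
  · refine Finset.card_eq_zero.2 (Finset.filter_eq_empty_iff.2 fun l hl h' => h ?_)
    obtain ⟨h0, h1⟩ := Finset.mem_Ioo.1 hl
    exact (key l h0 h1 h'.1 h'.2).2

theorem limitMeasure_real_singleton {k : ℕ} (hk : 3 ≤ k) {a m : ℕ} (ha : 0 < a) (ham : a < m)
    (hc : Nat.Coprime a m) : (limitMeasure k).real {nodeValue k (a / m)} = stairWidth k m := by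
  have h := hasSum_stairWidth_mul_coprimeNodeCount hk
    (measurableSet_singleton (nodeValue k (a / m)))
  refine h.unique ?_
  convert hasSum_single (m - 1) ?_ using 1
  · rw [coprimeNodeCount_singleton hk ha ham hc, Nat.sub_add_cancel (by omega), if_pos rfl]
    simp
  · intro n hn
    rw [coprimeNodeCount_singleton hk ha ham hc, if_neg (by omega)]
    simp

theorem hasSum_limitMeasure_real_Iio {k : ℕ} (hk : 3 ≤ k) {a m : ℕ} (ham : a < m) :
    HasSum (fun n : ℕ => stairWidth k (n + 1) * (coprimeCount a m (n + 1) : ℝ))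
      ((limitMeasure k).real (Iio (nodeValue k (a / m)))) := by
  simpa only [coprimeNodeCount_Iio hk ham] using
    hasSum_stairWidth_mul_coprimeNodeCount hk (measurableSet_Iio (a := nodeValue k (a / m)))

theorem exists_coprime_div_between {x y : ℝ} (hx : 0 ≤ x) (hxy : x < y) (hy : y ≤ 1) :
    ∃ a m : ℕ, 0 < a ∧ a < m ∧ Nat.Coprime a m ∧ x < a / m ∧ (a / m : ℝ) < y := by
  obtain ⟨r, h1, h2⟩ := exists_rat_btwn hxy
  have h0 : 0 < r := by exact_mod_cast hx.trans_lt h1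
  have hr1 : r < 1 := by exact_mod_cast h2.trans_le hy
  have hnum : 0 < r.num := Rat.num_pos.2 h0
  have hcast : ((r.num.natAbs : ℕ) : ℝ) = (r.num : ℝ) := by
    rw [← Int.cast_natCast, Int.natAbs_of_nonneg hnum.le]
  have hr : ((r.num.natAbs : ℕ) : ℝ) / (r.den : ℕ) = (r : ℝ) := by
    rw [hcast, ← Rat.cast_def]
  refine ⟨r.num.natAbs, r.den, by omega, ?_, r.reduced, by rwa [hr], by rwa [hr]⟩
  have : r.num < r.den := Rat.num_lt_denom_iff.2 hr1
  omega

theorem nodeSet_subset {k : ℕ} (hk : 3 ≤ k) :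
    nodeSet k ⊆ Ioo (nodeValue k 0) (nodeValue k 1) := by
  rintro x ⟨a, m, ha, ham, -, rfl⟩
  have hm : (0 : ℝ) < m := by exact_mod_cast ha.trans ham
  have ha' : (0 : ℝ) < a := by exact_mod_cast ha
  have hI := natCast_div_mem_Icc ham.le
  exact ⟨nodeValue_strictMonoOn hk (by simp) hI (by positivity),
    nodeValue_strictMonoOn hk hI (by simp) ((div_lt_one hm).2 (by exact_mod_cast ham))⟩

theorem exists_mem_nodeSet_between {k : ℕ} (hk : 3 ≤ k) {x y : ℝ} (hx : nodeValue k 0 ≤ x)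
    (hxy : x < y) (hy : y ≤ nodeValue k 1) : ∃ d ∈ nodeSet k, x < d ∧ d < y := by
  have hmono := nodeValue_strictMonoOn hk
  have hsurj := intermediate_value_Icc zero_le_one (continuous_nodeValue k).continuousOn
  obtain ⟨s, hs, rfl⟩ := hsurj ⟨hx, hxy.le.trans hy⟩
  obtain ⟨t, ht, rfl⟩ := hsurj ⟨hx.trans hxy.le, hy⟩
  obtain ⟨a, m, ha, ham, hc, h1, h2⟩ :=
    exists_coprime_div_between hs.1 ((hmono.lt_iff_lt hs ht).1 hxy) ht.2
  have hI := natCast_div_mem_Icc ham.le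
  exact ⟨_, ⟨a, m, ha, ham, hc, rfl⟩, hmono hs hI h1, hmono hI ht h2⟩

/-! ### Quantile functions of densely atomic measures -/

/-- `μ` is concentrated on a countable set `D` of atoms, which is dense in `[α, β]`. -/
structure DenselyAtomic (μ : Measure ℝ) (D : Set ℝ) (α β : ℝ) : Prop where
  lt : α < β
  countable : D.Countable
  subset : D ⊆ Ioo α β
  compl : μ Dᶜ = 0
  pos : ∀ d ∈ D, 0 < μ.real {d}
  dense : ∀ x y, α ≤ x → x < y → y ≤ β → ∃ d ∈ D, x < d ∧ d < y

/-- The quantile function of a distribution on `[α, β]`, extended to all real arguments. -/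
noncomputable def quantileOn (μ : Measure ℝ) (α β t : ℝ) : ℝ :=
  sInf {x | α ≤ x ∧ (β ≤ x ∨ t ≤ μ.real (Iic x))}

theorem real_Iio_eq_leftLim_cdf (μ : Measure ℝ) [IsProbabilityMeasure μ] (x : ℝ) :
    μ.real (Iio x) = Function.leftLim (ProbabilityTheory.cdf μ) x := by
  have h := (ProbabilityTheory.cdf μ).measure_Iio (ProbabilityTheory.tendsto_cdf_atBot μ) x
  rw [ProbabilityTheory.measure_cdf, sub_zero] at h
  rw [Measure.real, h, ENNReal.toReal_ofReal]
  exact ge_of_tendsto ((ProbabilityTheory.monotone_cdf μ).tendsto_leftLim x)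
    (Eventually.of_forall fun y => ProbabilityTheory.cdf_nonneg μ y)

theorem exists_lt_real_Iic_of_lt_real_Iio (μ : Measure ℝ) [IsProbabilityMeasure μ] {t x y : ℝ}
    (hyx : y < x) (h : t < μ.real (Iio x)) : ∃ z, y < z ∧ z < x ∧ t < μ.real (Iic z) := by
  rw [real_Iio_eq_leftLim_cdf] at h
  have h1 := ((ProbabilityTheory.monotone_cdf μ).tendsto_leftLim x).eventually (lt_mem_nhds h)
  obtain ⟨z, hz, hzI⟩ := (h1.and (Ioo_mem_nhdsLT hyx)).exists
  exact ⟨z, hzI.1, hzI.2, by rwa [← ProbabilityTheory.cdf_eq_real]⟩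

theorem real_Iic_eq_add (μ : Measure ℝ) [IsProbabilityMeasure μ] (x : ℝ) :
    μ.real (Iic x) = μ.real (Iio x) + μ.real {x} := by
  rw [← Iio_union_right, measureReal_union (by simp) (measurableSet_singleton x)]

namespace DenselyAtomic

variable {μ : Measure ℝ} {D : Set ℝ} {α β : ℝ}

/-- The clauses with `α` and `β` in `quantileOn` serve this: for every real `t` the set is bounded
below by `α` and contains `β`. -/
theorem quantileOn_mem (h : DenselyAtomic μ D α β) (t : ℝ) :
    quantileOn μ α β t ∈ Icc α β :=
  ⟨le_csInf ⟨β, h.lt.le, Or.inl le_rfl⟩ fun _ hx => hx.1,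
    csInf_le ⟨α, fun _ hx => hx.1⟩ ⟨h.lt.le, Or.inl le_rfl⟩⟩

theorem monotone_quantileOn (h : DenselyAtomic μ D α β) : Monotone (quantileOn μ α β) :=
  fun _ _ hst => csInf_le_csInf ⟨α, fun _ hx => hx.1⟩ ⟨β, h.lt.le, Or.inl le_rfl⟩
    fun _ hx => ⟨hx.1, hx.2.imp_right hst.trans⟩

variable [IsProbabilityMeasure μ]

theorem real_Iic_eq_zero (h : DenselyAtomic μ D α β) {x : ℝ} (hx : x ≤ α) :
    μ.real (Iic x) = 0 := by
  rw [measureReal_eq_zero_iff]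
  refine measure_mono_null (t := Dᶜ) (fun y hy hyD => ?_) h.compl
  exact (h.subset hyD).1.not_ge (le_trans hy hx)

theorem real_Iio_eq_one (h : DenselyAtomic μ D α β) {x : ℝ} (hx : β ≤ x) :
    μ.real (Iio x) = 1 := by
  have : μ (Iio x)ᶜ = 0 := by
    refine measure_mono_null (t := Dᶜ) (fun y hy hyD => ?_) h.compl
    exact (lt_of_lt_of_le (h.subset hyD).2 hx).not_ge (not_lt.1 hy)
  rw [Measure.real, (prob_compl_eq_zero_iff measurableSet_Iio).1 this, ENNReal.toReal_one]

theorem real_Iio_le_real_Iic (x : ℝ) : μ.real (Iio x) ≤ μ.real (Iic x) :=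
  measureReal_mono Iio_subset_Iic_self

theorem real_Iic_le_real_Iio {x y : ℝ} (hxy : x < y) : μ.real (Iic x) ≤ μ.real (Iio y) :=
  measureReal_mono (Iic_subset_Iio.2 hxy)

theorem real_Iic_eq_one (h : DenselyAtomic μ D α β) {x : ℝ} (hx : β ≤ x) :
    μ.real (Iic x) = 1 :=
  le_antisymm measureReal_le_one ((h.real_Iio_eq_one hx).ge.trans (real_Iio_le_real_Iic x))

theorem real_Iio_lt_real_Iic (h : DenselyAtomic μ D α β) {d : ℝ} (hd : d ∈ D) :
    μ.real (Iio d) < μ.real (Iic d) := by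
  rw [real_Iic_eq_add]
  linarith [h.pos d hd]

/-- An atom lies strictly between `x` and `y`. This strict growth is the source of the continuity of
the quantile function. -/
theorem real_Iic_lt_real_Iio (h : DenselyAtomic μ D α β) {x y : ℝ} (hx : α ≤ x) (hxy : x < y)
    (hy : y ≤ β) : μ.real (Iic x) < μ.real (Iio y) := by
  obtain ⟨d, hd, h1, h2⟩ := h.dense x y hx hxy hy
  exact (real_Iic_le_real_Iio h1).trans_lt
    ((h.real_Iio_lt_real_Iic hd).trans_le (real_Iic_le_real_Iio h2))

/-- The Galois connection between quantile and distribution function; right continuity of the latter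
handles the infimum. -/
theorem quantileOn_le_iff (h : DenselyAtomic μ D α β) {t x : ℝ} (hx : α ≤ x) (hxβ : x < β) :
    quantileOn μ α β t ≤ x ↔ t ≤ μ.real (Iic x) := by
  constructor
  · intro hle
    have hR : Tendsto (ProbabilityTheory.cdf μ) (𝓝[>] x) (𝓝 (ProbabilityTheory.cdf μ x)) :=
      ((ProbabilityTheory.cdf μ).right_continuous x).mono_left
        (nhdsWithin_mono _ Ioi_subset_Ici_self)
    rw [← ProbabilityTheory.cdf_eq_real]
    refine ge_of_tendsto hR ?_
    filter_upwards [Ioo_mem_nhdsGT hxβ] with y hy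
    obtain ⟨a, ⟨_, ha⟩, hay⟩ :=
      exists_lt_of_csInf_lt (s := {x | α ≤ x ∧ (β ≤ x ∨ t ≤ μ.real (Iic x))})
        ⟨β, h.lt.le, Or.inl le_rfl⟩ (hle.trans_lt hy.1)
    rw [ProbabilityTheory.cdf_eq_real]
    exact (ha.resolve_left (hay.trans hy.2).not_ge).trans
      (measureReal_mono (Iic_subset_Iic.2 hay.le))
  · exact fun ht => csInf_le ⟨α, fun _ hx => hx.1⟩ ⟨hx, Or.inr ht⟩

theorem lt_quantileOn_iff (h : DenselyAtomic μ D α β) {t x : ℝ} (hx : α ≤ x) (hxβ : x < β) :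
    x < quantileOn μ α β t ↔ μ.real (Iic x) < t := by
  rw [← not_le, h.quantileOn_le_iff hx hxβ, not_le]

/-- The strict counterpart, with left limits. The forward direction would fail if the distribution
function had a flat piece ending at `x`. -/
theorem quantileOn_lt_iff (h : DenselyAtomic μ D α β) {t x : ℝ} (hx : α < x) (hxβ : x ≤ β) :
    quantileOn μ α β t < x ↔ t < μ.real (Iio x) := by
  constructor
  · intro hlt
    have hle := (h.quantileOn_le_iff (h.quantileOn_mem t).1 (hlt.trans_le hxβ)).1 le_rfl
    exact hle.trans_lt (h.real_Iic_lt_real_Iio (h.quantileOn_mem t).1 hlt hxβ)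
  · intro ht
    obtain ⟨z, hz1, hz2, hz⟩ := exists_lt_real_Iic_of_lt_real_Iio μ hx ht
    exact ((h.quantileOn_le_iff hz1.le (hz2.trans_le hxβ)).2 hz.le).trans_lt hz2

theorem quantileOn_of_nonpos (h : DenselyAtomic μ D α β) {t : ℝ} (ht : t ≤ 0) :
    quantileOn μ α β t = α :=
  le_antisymm ((h.quantileOn_le_iff le_rfl h.lt).2 (ht.trans measureReal_nonneg))
    (h.quantileOn_mem t).1

theorem quantileOn_of_one_le (h : DenselyAtomic μ D α β) {t : ℝ} (ht : 1 ≤ t) :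
    quantileOn μ α β t = β := by
  refine le_antisymm (h.quantileOn_mem t).2 (not_lt.1 fun hlt => ?_)
  rw [h.quantileOn_lt_iff h.lt le_rfl] at hlt
  exact (hlt.trans_le measureReal_le_one).not_ge ht

/-- By the two preceding equivalences, preimages of open rays are open rays, or trivial when the
bound is outside the range. -/
theorem continuous_quantileOn (h : DenselyAtomic μ D α β) : Continuous (quantileOn μ α β) := by
  refine OrderTopology.continuous_iff.2 fun x => ⟨?_, ?_⟩
  · rcases lt_or_ge x α with hx | hx
    · convert isOpen_univ
      exact eq_univ_of_forall fun t => hx.trans_le (h.quantileOn_mem t).1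
    rcases lt_or_ge x β with hxβ | hxβ
    · convert isOpen_Ioi (a := μ.real (Iic x))
      ext t
      exact h.lt_quantileOn_iff hx hxβ
    · convert isOpen_empty
      exact eq_empty_of_forall_notMem fun t ht =>
        (lt_of_le_of_lt hxβ ht).not_ge (h.quantileOn_mem t).2
  · rcases le_or_gt x α with hx | hx
    · convert isOpen_empty
      exact eq_empty_of_forall_notMem fun t ht =>
        (lt_of_lt_of_le ht hx).not_ge (h.quantileOn_mem t).1
    rcases le_or_gt x β with hxβ | hxβ
    · convert isOpen_Iio (a := μ.real (Iio x))
      ext t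
      exact h.quantileOn_lt_iff hx hxβ
    · convert isOpen_univ
      exact eq_univ_of_forall fun t => (h.quantileOn_mem t).2.trans_lt hxβ

theorem setOf_le_real_Iic (h : DenselyAtomic μ D α β) {t : ℝ} (ht : t ∈ Ioo (0 : ℝ) 1) :
    {x | t ≤ μ.real (Iic x)} = Ici (quantileOn μ α β t) := by
  ext x
  change t ≤ μ.real (Iic x) ↔ quantileOn μ α β t ≤ x
  rcases lt_or_ge x α with hx | hx
  · rw [h.real_Iic_eq_zero hx.le]
    exact iff_of_false ht.1.not_ge (hx.trans_le (h.quantileOn_mem t).1).not_ge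
  rcases lt_or_ge x β with hxβ | hxβ
  · exact (h.quantileOn_le_iff hx hxβ).symm
  · rw [h.real_Iic_eq_one hxβ]
    exact iff_of_true ht.2.le ((h.quantileOn_mem t).2.trans hxβ)

/-- The extended quantile function as a Stieltjes function. -/
noncomputable def stieltjes (h : DenselyAtomic μ D α β) : StieltjesFunction ℝ where
  toFun := quantileOn μ α β
  mono' := h.monotone_quantileOn
  right_continuous' _ := h.continuous_quantileOn.continuousWithinAt

theorem stieltjes_apply (h : DenselyAtomic μ D α β) (t : ℝ) :
    h.stieltjes t = quantileOn μ α β t := rfl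

theorem quantileOn_eq (h : DenselyAtomic μ D α β) {d t : ℝ} (hd : d ∈ D)
    (ht : t ∈ Icc (μ.real (Iio d)) (μ.real (Iic d))) : quantileOn μ α β t = d := by
  obtain ⟨h1, h2⟩ := h.subset hd
  exact le_antisymm ((h.quantileOn_le_iff h1.le h2).2 ht.2)
    (not_lt.1 fun hlt => ((h.quantileOn_lt_iff h1 h2.le).1 hlt).not_ge ht.1)

/-- A point is outside the support exactly when the quantile function is constant near it. Outside
`[0, 1]` this is automatic; inside, a value taken on a whole interval must be an atom. -/
theorem support_stieltjes (h : DenselyAtomic μ D α β) : h.stieltjes.measure.support =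
    Icc 0 1 \ ⋃ d ∈ D, Ioo (μ.real (Iio d)) (μ.real (Iic d)) := by
  have hnull : ∀ {a b t : ℝ}, a < t → t < b → quantileOn μ α β a = quantileOn μ α β b →
      t ∉ h.stieltjes.measure.support := by
    intro a b t ha hb he
    refine Measure.notMem_support_iff_exists.2 ⟨Ioc a b, Ioc_mem_nhds ha hb, ?_⟩
    rw [StieltjesFunction.measure_Ioc, h.stieltjes_apply, h.stieltjes_apply, he, sub_self,
      ENNReal.ofReal_zero]
  ext t
  constructor
  · intro ht
    refine ⟨⟨not_lt.1 fun h0 => ?_, not_lt.1 fun h1 => ?_⟩, fun hU => ?_⟩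
    · exact hnull (sub_one_lt t) h0 (by
        rw [h.quantileOn_of_nonpos le_rfl, h.quantileOn_of_nonpos (by linarith)]) ht
    · exact hnull h1 (lt_add_one t) (by
        rw [h.quantileOn_of_one_le le_rfl, h.quantileOn_of_one_le (by linarith)]) ht
    · simp only [mem_iUnion, exists_prop] at hU
      obtain ⟨d, hd, h1, h2⟩ := hU
      exact hnull h1 h2 (by rw [h.quantileOn_eq hd ⟨le_rfl, (h1.trans h2).le⟩,
        h.quantileOn_eq hd ⟨(h1.trans h2).le, le_rfl⟩]) ht
  · rintro ⟨⟨h0, h1⟩, hU⟩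
    by_contra ht
    obtain ⟨U, hU', hU0⟩ := Measure.notMem_support_iff_exists.1 ht
    obtain ⟨ε, hε, hsub⟩ := Metric.nhds_basis_closedBall.mem_iff.1 hU'
    rw [Real.closedBall_eq_Icc] at hsub
    have hm := measure_mono_null (Ioc_subset_Icc_self.trans hsub) hU0
    rw [StieltjesFunction.measure_Ioc, ENNReal.ofReal_eq_zero, h.stieltjes_apply,
      h.stieltjes_apply, sub_nonpos] at hm
    have he := hm.antisymm (h.monotone_quantileOn (by linarith : t - ε ≤ t + ε))
    -- The constant value on `[t - ε, t + ε]`. It is not `α` since `t + ε > 0`, nor `β` since `t - ε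
    -- < 1`; the distribution function then jumps at `x` from at most `t - ε` to at least `t + ε`.
    set x := quantileOn μ α β (t - ε) with hx
    have hxI := h.quantileOn_mem (t - ε)
    rw [← hx] at hxI
    have hαx : α < x := by
      refine hxI.1.lt_of_ne fun hα => ?_
      have := (h.quantileOn_le_iff le_rfl h.lt).1 (he.le.trans hα.ge)
      rw [h.real_Iic_eq_zero le_rfl] at this
      linarith
    have hxβ : x < β := by
      rw [hx, h.quantileOn_lt_iff h.lt le_rfl, h.real_Iio_eq_one le_rfl]
      linarith
    have hle := (h.quantileOn_le_iff hαx.le hxβ).1 he.le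
    have hge : μ.real (Iio x) ≤ t - ε :=
      not_lt.1 fun hlt => lt_irrefl _ ((h.quantileOn_lt_iff hαx hxβ.le).2 hlt)
    have hxD : x ∈ D := by
      by_contra hxD
      have : μ.real {x} = 0 := by
        rw [measureReal_eq_zero_iff]
        exact measure_mono_null (singleton_subset_iff.2 hxD) h.compl
      rw [real_Iic_eq_add, this] at hle
      linarith
    exact hU (mem_biUnion hxD ⟨by linarith, by linarith⟩)

theorem pairwiseDisjoint_Ioo (s : Set ℝ) :
    s.PairwiseDisjoint fun d => Ioo (μ.real (Iio d)) (μ.real (Iic d)) := by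
  have key : ∀ {d e : ℝ}, d < e → Disjoint (Ioo (μ.real (Iio d)) (μ.real (Iic d)))
      (Ioo (μ.real (Iio e)) (μ.real (Iic e))) := fun hlt =>
    disjoint_left.2 fun t h1 h2 =>
      (h1.2.trans_le (real_Iic_le_real_Iio hlt)).not_gt h2.1
  intro d _ e _ hne
  rcases lt_or_gt_of_ne hne with hlt | hlt
  · exact key hlt
  · exact (key hlt).symm

/-- The removed intervals are disjoint, and their lengths are the masses of the atoms, with total 1.
-/
theorem volume_support_stieltjes (h : DenselyAtomic μ D α β) :
    volume h.stieltjes.measure.support = 0 := by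
  have hU : volume (⋃ d ∈ D, Ioo (μ.real (Iio d)) (μ.real (Iic d))) = 1 := by
    rw [measure_biUnion h.countable (pairwiseDisjoint_Ioo D) fun _ _ => measurableSet_Ioo]
    have : ∀ d : ℝ, volume (Ioo (μ.real (Iio d)) (μ.real (Iic d))) = μ {d} := by
      intro d
      rw [Real.volume_Ioo, real_Iic_eq_add, add_sub_cancel_left, ofReal_measureReal]
    simp only [this]
    rw [← measure_biUnion (f := fun d : ℝ => {d}) h.countable (pairwiseDisjoint_fiber id D)
      fun d _ => measurableSet_singleton d, biUnion_of_singleton]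
    exact (prob_compl_eq_zero_iff h.countable.measurableSet).1 h.compl
  rw [h.support_stieltjes, measure_sdiff _ _ (by rw [hU]; exact ENNReal.one_ne_top), hU,
    Real.volume_Icc, sub_zero, ENNReal.ofReal_one, tsub_self]
  · exact iUnion₂_subset fun d _ => Ioo_subset_Icc_self.trans
      (Icc_subset_Icc measureReal_nonneg measureReal_le_one)
  · exact (MeasurableSet.biUnion h.countable fun _ _ => measurableSet_Ioo).nullMeasurableSet

theorem mutuallySingular_stieltjes (h : DenselyAtomic μ D α β) :
    h.stieltjes.measure ⟂ₘ volume :=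
  Measure.MutuallySingular.symm ⟨h.stieltjes.measure.support,
    Measure.isClosed_support.measurableSet, h.volume_support_stieltjes,
    Measure.measure_compl_support⟩

theorem isLeast_support (h : DenselyAtomic μ D α β) : IsLeast h.stieltjes.measure.support 0 := by
  rw [h.support_stieltjes]
  refine ⟨⟨by simp, fun hU => ?_⟩, fun x hx => hx.1.1⟩
  obtain ⟨d, -, hd⟩ := mem_iUnion₂.1 hU
  exact hd.1.not_ge measureReal_nonneg

theorem isGreatest_support (h : DenselyAtomic μ D α β) :
    IsGreatest h.stieltjes.measure.support 1 := by
  rw [h.support_stieltjes]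
  refine ⟨⟨by simp, fun hU => ?_⟩, fun x hx => hx.1.2⟩
  obtain ⟨d, -, hd⟩ := mem_iUnion₂.1 hU
  exact hd.2.not_ge measureReal_le_one

theorem notMem_biUnion_Ioo {d : ℝ} :
    μ.real (Iio d) ∉ (⋃ e ∈ D, Ioo (μ.real (Iio e)) (μ.real (Iic e))) ∧
    μ.real (Iic d) ∉ ⋃ e ∈ D, Ioo (μ.real (Iio e)) (μ.real (Iic e)) := by
  refine ⟨fun hU => ?_, fun hU => ?_⟩ <;> obtain ⟨e, -, h1, h2⟩ := mem_iUnion₂.1 hU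
  · rcases lt_or_ge e d with hlt | hle
    · exact (real_Iic_le_real_Iio hlt).not_gt h2
    · exact (measureReal_mono (Iio_subset_Iio hle)).not_gt h1
  · rcases lt_or_ge d e with hlt | hle
    · exact (real_Iic_le_real_Iio hlt).not_gt h1
    · exact (measureReal_mono (Iic_subset_Iic.2 hle)).not_gt h2

theorem gapEndpoints_support (h : DenselyAtomic μ D α β) :
    gapEndpoints h.stieltjes.measure.support =
      {x | ∃ d ∈ D, x = μ.real (Iio d) ∨ x = μ.real (Iic d)} := by
  have hmem : ∀ d : ℝ, μ.real (Iio d) ∈ h.stieltjes.measure.support ∧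
      μ.real (Iic d) ∈ h.stieltjes.measure.support := fun d => by
    rw [h.support_stieltjes]
    exact ⟨⟨⟨measureReal_nonneg, measureReal_le_one⟩, notMem_biUnion_Ioo.1⟩,
      ⟨⟨measureReal_nonneg, measureReal_le_one⟩, notMem_biUnion_Ioo.2⟩⟩
  ext x
  constructor
  · rintro ⟨u, v, huv, hu, hv, hdisj, hx⟩
    obtain ⟨t, ht1, ht2⟩ := exists_between huv
    have htS := disjoint_left.1 hdisj ⟨ht1, ht2⟩
    rw [h.support_stieltjes] at htS hu hv
    have htU : t ∈ ⋃ d ∈ D, Ioo (μ.real (Iio d)) (μ.real (Iic d)) := by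
      by_contra htU
      exact htS ⟨⟨hu.1.1.trans ht1.le, ht2.le.trans hv.1.2⟩, htU⟩
    obtain ⟨d, hd, hd1, hd2⟩ := mem_iUnion₂.1 htU
    -- The gap and the flat piece of `d` share the point `t`, and neither contains an endpoint of
    -- the other, so they coincide.
    have e1 : u ≤ μ.real (Iio d) := not_lt.1 fun hlt =>
      hu.2 (mem_biUnion hd ⟨hlt, ht1.trans hd2⟩)
    have e2 : μ.real (Iic d) ≤ v := not_lt.1 fun hlt =>
      hv.2 (mem_biUnion hd ⟨hd1.trans ht2, hlt⟩)
    have e3 : μ.real (Iio d) ≤ u := not_lt.1 fun hlt =>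
      disjoint_left.1 hdisj ⟨hlt, hd1.trans ht2⟩ (hmem d).1
    have e4 : v ≤ μ.real (Iic d) := not_lt.1 fun hlt =>
      disjoint_left.1 hdisj ⟨ht1.trans hd2, hlt⟩ (hmem d).2
    rw [← e3.antisymm e1, e4.antisymm e2] at hx
    exact ⟨d, hd, hx⟩
  · rintro ⟨d, hd, hx⟩
    refine ⟨_, _, h.real_Iio_lt_real_Iic hd, (hmem d).1, (hmem d).2, ?_, hx⟩
    rw [h.support_stieltjes]
    exact disjoint_left.2 fun t ht hS => hS.2 (mem_biUnion hd ht)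

/-- Pointwise convergence of distribution functions gives that of quantile functions. -/
theorem tendsto_quantile (h : DenselyAtomic μ D α β) {ν : ℕ → ProbabilityMeasure ℝ}
    (hν : ∀ x, Tendsto (fun n => (ν n : Measure ℝ).real (Iic x)) atTop (𝓝 (μ.real (Iic x))))
    {t : ℝ} (ht : t ∈ Ioo (0 : ℝ) 1) :
    Tendsto (fun n => quantile (ν n) t) atTop (𝓝 (quantileOn μ α β t)) := by
  have hset := h.setOf_le_real_Iic ht
  have hnonempty : ∀ n, {x | t ≤ (ν n : Measure ℝ).real (Iic x)}.Nonempty := by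
    intro n
    obtain ⟨x, hx⟩ := ((ProbabilityTheory.tendsto_cdf_atTop (ν n : Measure ℝ)).eventually
      (lt_mem_nhds ht.2)).exists
    exact ⟨x, by rw [ProbabilityTheory.cdf_eq_real] at hx; exact hx.le⟩
  have hbdd : ∀ n, BddBelow {x | t ≤ (ν n : Measure ℝ).real (Iic x)} := by
    intro n
    obtain ⟨x, hx⟩ := ((ProbabilityTheory.tendsto_cdf_atBot (ν n : Measure ℝ)).eventually
      (gt_mem_nhds ht.1)).exists
    rw [ProbabilityTheory.cdf_eq_real] at hx
    exact ⟨x, fun y hy => not_lt.1 fun hlt =>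
      ((measureReal_mono (Iic_subset_Iic.2 hlt.le)).trans_lt hx).not_ge hy⟩
  refine tendsto_order.2 ⟨fun x hx => ?_, fun x hx => ?_⟩
  · obtain ⟨y, hxy, hy⟩ := exists_between hx
    have hyt : μ.real (Iic y) < t := not_le.1 fun hle => by
      have : y ∈ {x | t ≤ μ.real (Iic x)} := hle
      rw [hset] at this
      exact hy.not_ge this
    filter_upwards [(hν y).eventually (gt_mem_nhds hyt)] with n hn
    refine hxy.trans_le (le_csInf (hnonempty n) fun z hz => not_lt.1 fun hlt => ?_)
    exact ((measureReal_mono (Iic_subset_Iic.2 hlt.le)).trans_lt hn).not_ge hz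
  · obtain ⟨y, hy, hyx⟩ := exists_between hx
    -- Strictness, needed to pass to the approximating measures, comes from the absence of flat
    -- pieces of the distribution function.
    have hty : t < μ.real (Iic y) := by
      rcases le_or_gt y β with hyβ | hyβ
      · exact ((h.quantileOn_lt_iff ((h.quantileOn_mem t).1.trans_lt hy) hyβ).1 hy).trans_le
          (real_Iio_le_real_Iic y)
      · rw [h.real_Iic_eq_one hyβ.le]
        exact ht.2
    filter_upwards [(hν y).eventually (lt_mem_nhds hty)] with n hn
    exact (csInf_le (hbdd n) hn.le).trans_lt hyx

end DenselyAtomic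

/-! ### Application to the spectra of the trees -/

theorem uniformNSpec_apply (k n : ℕ) {E : Set ℝ} (hE : MeasurableSet E) :
    (uniformNSpec k n : Measure ℝ) E = ENNReal.ofReal
      ((rootCount k E ((regularSubtree k n).adjMatrix ℝ).charpoly : ℝ) / (treeBall k n).card) := by
  classical
  change ((PMF.uniformOfFintype (treeBall k n)).map (nSpec k n)).toMeasure E = _
  have hcard : (0 : ℝ) < (treeBall k n).card := by
    exact_mod_cast Finset.card_pos.2 ⟨[], nil_mem_treeBall k n⟩
  rw [PMF.toMeasure_apply_eq_toOuterMeasure_apply _ hE, PMF.toOuterMeasure_map_apply,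
    PMF.toOuterMeasure_uniformOfFintype_apply, rootCount_charpoly,
    ENNReal.ofReal_div_of_pos hcard, ENNReal.ofReal_natCast, ENNReal.ofReal_natCast,
    Fintype.card_coe, Fintype.card_subtype]
  rfl

/-- Convergence on all measurable sets is stronger than weak convergence: it includes distribution
functions at the atoms of the limit, as `DenselyAtomic.tendsto_quantile` requires. -/
theorem tendsto_uniformNSpec_apply {k : ℕ} (hk : 3 ≤ k) {E : Set ℝ} (hE : MeasurableSet E) :
    Tendsto (fun n => (uniformNSpec k n : Measure ℝ) E) atTop (𝓝 (limitMeasure k E)) := by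
  refine (tendsto_add_atTop_iff_nat 1).1 ?_
  simp only [uniformNSpec_apply k _ hE, limitMeasure_real hk hE]
  exact ENNReal.tendsto_ofReal (tendsto_rootCount_div_card hk E)

theorem denselyAtomic_limitMeasure {k : ℕ} (hk : 3 ≤ k) :
    DenselyAtomic (limitMeasure k) (nodeSet k) (nodeValue k 0) (nodeValue k 1) where
  lt := nodeValue_strictMonoOn hk (by simp) (by simp) one_pos
  countable := countable_nodeSet k
  subset := nodeSet_subset hk
  compl := limitMeasure_compl_nodeSet hk
  pos := by
    rintro d ⟨a, m, ha, ham, hc, rfl⟩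
    rw [limitMeasure_real_singleton hk ha ham hc]
    exact stairWidth_pos hk (by omega)
  dense _ _ hx hxy hy := exists_mem_nodeSet_between hk hx hxy hy

/-- The series is the mass to the left of the atom at `a / m`; taking `ε = 1` adds the mass of the
atom itself. -/
theorem stairEndpoints_eq {k : ℕ} (hk : 3 ≤ k) : stairEndpoints k =
    {x | ∃ d ∈ nodeSet k, x = (limitMeasure k).real (Iio d) ∨
      x = (limitMeasure k).real (Iic d)} := by
  have := isProbabilityMeasure_limitMeasure hk
  ext x
  constructor
  · rintro ⟨m, a, ε, s, ha, ham, hc, hε, hs, rfl⟩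
    refine ⟨_, ⟨a, m, ha, ham, hc, rfl⟩, ?_⟩
    rw [hs.unique (hasSum_limitMeasure_real_Iio hk ham), real_Iic_eq_add,
      limitMeasure_real_singleton hk ha ham hc]
    rcases hε with rfl | rfl
    · left; ring
    · right; ring
  · rintro ⟨_, ⟨a, m, ha, ham, hc, rfl⟩, hx⟩
    have hs := hasSum_limitMeasure_real_Iio hk ham
    rw [real_Iic_eq_add, limitMeasure_real_singleton hk ha ham hc] at hx
    rcases hx with rfl | rfl
    · exact ⟨m, a, 0, _, ha, ham, hc, Or.inl rfl, hs, by ring⟩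
    · exact ⟨m, a, 1, _, ha, ham, hc, Or.inr rfl, hs, by ring⟩

theorem theorem6 (k : ℕ) (hk : 3 ≤ k) :
    ∃ (μ : ProbabilityMeasure ℝ) (F : StieltjesFunction ℝ),
      -- the uniform distributions on the normalized spectra converge, to a singular limit
      Tendsto (fun n => uniformNSpec k n) atTop (𝓝 μ) ∧
      (μ : Measure ℝ) ⟂ₘ volume ∧
      -- the ordered plots of the normalized eigenvalues converge to the one of the limit
      (∀ t ∈ Ioo (0 : ℝ) 1,
        F t = quantile μ t ∧
        Tendsto (fun n => quantile (uniformNSpec k n) t) atTop (𝓝 (F t))) ∧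
      (∀ t ≤ 0, F t = F 0) ∧ (∀ t ≥ 1, F t = F 1) ∧
      -- the limiting plot is a Devil's staircase: continuous and singular
      Continuous F ∧
      F.measure ⟂ₘ volume ∧
      volume F.measure.support = 0 ∧
      IsLeast F.measure.support 0 ∧ IsGreatest F.measure.support 1 ∧
      -- the endpoints of its support
      gapEndpoints F.measure.support = stairEndpoints k := by
  have := isProbabilityMeasure_limitMeasure hk
  have h := denselyAtomic_limitMeasure hk
  refine ⟨⟨limitMeasure k, this⟩, h.stieltjes, ?_, ?_, fun t ht => ⟨?_, ?_⟩, fun t ht => ?_,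
    fun t ht => ?_, h.continuous_quantileOn, h.mutuallySingular_stieltjes,
    h.volume_support_stieltjes, h.isLeast_support, h.isGreatest_support, ?_⟩
  -- The open-set criterion of the portmanteau theorem, here with equality.
  · exact tendsto_of_forall_isOpen_le_liminf' fun G hG =>
      (tendsto_uniformNSpec_apply hk hG.measurableSet).liminf_eq.ge
  · exact ⟨(nodeSet k)ᶜ, h.countable.measurableSet.compl, h.compl, by
      rw [compl_compl]; exact h.countable.measure_zero _⟩
  · exact (csInf_Ici.symm.trans (congrArg sInf (h.setOf_le_real_Iic ht).symm) :)
  · exact h.tendsto_quantile (fun x => (ENNReal.tendsto_toReal (measure_ne_top _ _)).comp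
      (tendsto_uniformNSpec_apply hk measurableSet_Iic)) ht
  · exact (h.quantileOn_of_nonpos ht).trans (h.quantileOn_of_nonpos le_rfl).symm
  · exact (h.quantileOn_of_one_le ht).trans (h.quantileOn_of_one_le le_rfl).symm
  · rw [h.gapEndpoints_support, stairEndpoints_eq hk]
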